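/- **Theorem.** For every integer $r\ge 3$, the complete graph $K_{2r+3}$ embeds in the real projective space $P^3$ as a quadrangulation. Here a *generalised simplicial complex* $K$ is a finite regular $\Delta$-complex: a Hausdorff space $\|K\|$ (its polyhedron) that is the disjoint union of the interiors of finitely many embedded simplices, the interior of every face of each of these simplices being again the interior of one of them, of the same dimension; different simplices may have the same vertex set. In particular the $1$-skeleton $K^{(1)}$ may have parallel edges. A *quadrangulation* of $K$ is a simple spanning subgraph $G$ of $K^{(1)}$ such that for every inclusionwise maximal simplex $\sigma$ of $K$, the subgraph of $G$ induced by $\sigma$ (whose vertices are the vertices of $\sigma$ and whose edges are the edges of $\sigma$ that belong to $G$) is a complete bipartite graph with at least one edge. A graph *embeds in a topological space $X$ as a quadrangulation* if it is isomorphic to a quadrangulation of some generalised simplicial complex whose polyhedron is homeomorphic to $X$. -/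

import Mathlib

open scoped LinearAlgebra.Projectivization

/-- Real projective `n`-space `P^n`: the lines through the origin of `ℝ^(n+1)`. -/
abbrev RealProjectiveSpace (n : ℕ) : Type :=
  ℙ ℝ (EuclideanSpace ℝ (Fin (n + 1)))

/-- The usual topology of `P^n`: the quotient topology from `ℝ^(n+1) \ {0}`. -/
noncomputable instance RealProjectiveSpace.instTopologicalSpace (n : ℕ) :
    TopologicalSpace (RealProjectiveSpace n) :=
  TopologicalSpace.coinduced
    (Projectivization.mk' ℝ : {v : EuclideanSpace ℝ (Fin (n + 1)) // v ≠ 0} → _) inferInstance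

/-- The relative interior of the face of the standard `n`-simplex spanned by the set `S` of
its vertices. -/
def simplexOpenFace {n : ℕ} (S : Finset (Fin (n + 1))) : Set (stdSimplex ℝ (Fin (n + 1))) :=
  {t | ∀ i, 0 < t.1 i ↔ i ∈ S}

/-- A finite generalised simplicial complex (regular `Δ`-complex), presented by its polyhedron
together with the characteristic maps of its cells. Each cell is an embedded simplex, the
interior of every face of a cell is the interior of a cell of the same dimension, and every
point of the polyhedron lies in the interior of exactly one cell. Several cells may have the
same set of vertices. (As the polyhedron is Hausdorff and there are finitely many cells, all
characteristic maps are homeomorphisms onto closed subsets, and the polyhedron has the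
topology obtained by gluing the simplices.) -/
structure GeneralizedSimplicialComplex where
  /-- the polyhedron `‖K‖` -/
  Polyhedron : Type
  topology : TopologicalSpace Polyhedron
  hausdorff : T2Space Polyhedron
  /-- the cells (faces, simplices) -/
  Cell : Type
  finite_cell : Finite Cell
  dim : Cell → ℕ
  charMap : (c : Cell) → stdSimplex ℝ (Fin (dim c + 1)) → Polyhedron
  continuous_charMap : ∀ c, Continuous (charMap c)
  injective_charMap : ∀ c, Function.Injective (charMap c)
  exists_face : ∀ (c : Cell) (S : Finset (Fin (dim c + 1))), S.Nonempty →
    ∃ d : Cell, dim d + 1 = S.card ∧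
      charMap d '' simplexOpenFace Finset.univ = charMap c '' simplexOpenFace S
  existsUnique_cell : ∀ x : Polyhedron, ∃! c : Cell, x ∈ charMap c '' simplexOpenFace Finset.univ

attribute [instance] GeneralizedSimplicialComplex.topology
attribute [instance] GeneralizedSimplicialComplex.hausdorff
attribute [instance] GeneralizedSimplicialComplex.finite_cell

namespace GeneralizedSimplicialComplex

/-- `c` is a face of `d` (every cell is a face of itself). -/
def IsFace (K : GeneralizedSimplicialComplex) (c d : K.Cell) : Prop :=
  Set.range (K.charMap c) ⊆ Set.range (K.charMap d)

/-- Inclusionwise maximal simplices. -/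
def IsMaximal (K : GeneralizedSimplicialComplex) (c : K.Cell) : Prop :=
  ∀ d : K.Cell, K.IsFace c d → d = c

/-- The vertices of `K`. -/
abbrev Vertex (K : GeneralizedSimplicialComplex) : Type :=
  {v : K.Cell // K.dim v = 0}

/-- The edges of the `1`-skeleton of `K`, which may have parallel edges. -/
abbrev Edge (K : GeneralizedSimplicialComplex) : Type :=
  {e : K.Cell // K.dim e = 1}

/-- `u` and `v` are the two (distinct) ends of the edge `e`. -/
def Joins (K : GeneralizedSimplicialComplex) (e : K.Edge) (u v : K.Vertex) : Prop :=
  u ≠ v ∧ K.IsFace u.1 e.1 ∧ K.IsFace v.1 e.1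

/-- The graph on all vertices of `K` whose edges are the members of a set `E` of edges of the
`1`-skeleton. -/
def spanningGraph (K : GeneralizedSimplicialComplex) (E : Set K.Edge) : SimpleGraph K.Vertex where
  Adj u v := ∃ e ∈ E, K.Joins e u v
  symm := ⟨fun _ _ ⟨e, he, hne, hu, hv⟩ => ⟨e, he, hne.symm, hv, hu⟩⟩
  loopless := ⟨fun _ ⟨_, _, hne, _⟩ => hne rfl⟩

/-- The subgraph induced by the simplex `c`: the vertices of `c`, and the members of `E` that
are edges of `c`. -/
def inducedGraph (K : GeneralizedSimplicialComplex) (E : Set K.Edge) (c : K.Cell) :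
    SimpleGraph {v : K.Vertex // K.IsFace v.1 c} where
  Adj u v := ∃ e ∈ E, K.IsFace e.1 c ∧ K.Joins e u.1 v.1
  symm := ⟨fun _ _ ⟨e, he, hc, hne, hu, hv⟩ => ⟨e, he, hc, hne.symm, hv, hu⟩⟩
  loopless := ⟨fun _ ⟨_, _, _, hne, _⟩ => hne rfl⟩

end GeneralizedSimplicialComplex

/-- `G` is complete bipartite: for some set `A` of vertices, the edges are exactly the pairs
with one end in `A` and the other one outside `A`. -/
def IsCompleteBipartiteGraph {V : Type*} (G : SimpleGraph V) : Prop :=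
  ∃ A : Set V, ∀ u v, G.Adj u v ↔ (u ∈ A ∧ v ∉ A ∨ u ∉ A ∧ v ∈ A)

/-- The spanning subgraph of the `1`-skeleton of `K` with edge set `E` is a quadrangulation of
`K`: it is simple (no two parallel edges), and every maximal simplex of `K` induces a complete
bipartite subgraph with at least one edge. -/
structure IsQuadrangulation (K : GeneralizedSimplicialComplex) (E : Set K.Edge) : Prop where
  simple : ∀ e ∈ E, ∀ f ∈ E, ∀ u v : K.Vertex, K.Joins e u v → K.Joins f u v → e = f
  completeBipartite : ∀ c, K.IsMaximal c → IsCompleteBipartiteGraph (K.inducedGraph E c)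
  exists_edge : ∀ c, K.IsMaximal c → ∃ e ∈ E, K.IsFace e.1 c

/-- `G` embeds in `X` as a quadrangulation: it is isomorphic to a quadrangulation of a
generalised simplicial complex whose polyhedron is homeomorphic to `X`. -/
def EmbedsAsQuadrangulation {V : Type*} (G : SimpleGraph V) (X : Type*) [TopologicalSpace X] :
    Prop :=
  ∃ K : GeneralizedSimplicialComplex, Nonempty (K.Polyhedron ≃ₜ X) ∧
    ∃ E : Set K.Edge, IsQuadrangulation K E ∧ Nonempty (G ≃g K.spanningGraph E)

open scoped Pointwise

/-! The complex on `P^3` is the quotient of an antipodally symmetric decomposition of the 3-sphere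
into simplices, whose vertices have two colours exchanged by the antipode. The quadrangulation
consists of the images of the edges with ends of different colours. A simplex then induces the
complete bipartite graph between its two colour classes, and it has an edge as soon as no
monochromatic simplex is maximal.

The sphere has, in each colour, a cycle of length `n`, an apex and a pole, so that its antipodal
quotient has `n + 2` vertices; `n = 2r + 1` gives the theorem. The cycles are unrolled to `ℤ`, and
the square of the lifted antipode is a shift by `-n`. Index `i` of colour true is joined to index
`j` of colour false when `i + 1 ≤ j ≤ i + n - 1`, which excludes exactly the antipode of `i` modulo
`n`. The pairs `(i, j)` fill a strip bounded by two staircases. The apex of colour true cones off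
the lower staircase and the apex of colour false the upper one. Each pole joins simplices without
vertices of the cycle of its own colour.

That this is a sphere is checked by an explicit map `toSpace` to `ℝ⁴`, which is odd under the
antipode. If the cycles carry masses `p`, `q` at mean positions `x`, `y`, then `p + q` is the
distance from an axis, the weighted mean position is an angle, `q - p` with the poles added is the
third coordinate, and the position across the strip with the apices added is the fourth. Every line
through the origin is hit (`exists_toSpace_eq_smul`), by one orbit only
(`exists_zpow_of_toSpace_eq_smul`). The passage from such a map to a cell structure and a
quadrangulation is independent of the example (`ProjectiveModel`). -/

instance RealProjectiveSpace.instT2Space (n : ℕ) : T2Space (RealProjectiveSpace n) := by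
  -- The matrix of the orthogonal projection onto the line of `v`: it depends continuously on the
  -- line and determines it.
  let f : {v : EuclideanSpace ℝ (Fin (n + 1)) // v ≠ 0} → Fin (n + 1) → Fin (n + 1) → ℝ :=
    fun v i j => v.1 i * v.1 j / ‖v.1‖ ^ 2
  have hf : ∀ a b : {v : EuclideanSpace ℝ (Fin (n + 1)) // v ≠ 0}, ∀ t : ℝ,
      (a : EuclideanSpace ℝ (Fin (n + 1))) = t • (b : EuclideanSpace ℝ (Fin (n + 1))) →
        f a = f b := by
    rintro ⟨a, ha⟩ ⟨b, hb⟩ t h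
    obtain rfl : a = t • b := h
    have ht : t ≠ 0 := by rintro rfl; simp at ha
    have hb' : ‖b‖ ≠ 0 := norm_ne_zero_iff.2 hb
    ext i j
    simp only [f, PiLp.smul_apply, smul_eq_mul, norm_smul, mul_pow, Real.norm_eq_abs, sq_abs]
    field_simp
  let F : RealProjectiveSpace n → Fin (n + 1) → Fin (n + 1) → ℝ := Projectivization.lift f hf
  have hF : Continuous F := by
    refine continuous_coinduced_dom.2 ?_
    have : F ∘ (Projectivization.mk' ℝ) = f := by
      ext v : 1
      exact Projectivization.lift_mk f hf v.1 v.2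
    rw [this]
    refine continuous_pi fun i => continuous_pi fun j => ?_
    refine Continuous.div (by fun_prop) (by fun_prop) fun v => ?_
    exact pow_ne_zero _ (norm_ne_zero_iff.2 v.2)
  refine T2Space.of_injective_continuous (f := F) ?_ hF
  intro p q
  induction p using Projectivization.ind with | _ v hv
  induction q using Projectivization.ind with | _ w hw
  intro h
  change f ⟨v, hv⟩ = f ⟨w, hw⟩ at h
  obtain ⟨j, hj⟩ : ∃ j, w j ≠ 0 := by
    by_contra! hc
    exact hw (by ext i; simpa using hc i)
  have hv' : ‖v‖ ^ 2 ≠ 0 := pow_ne_zero _ (norm_ne_zero_iff.2 hv)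
  have hw' : ‖w‖ ^ 2 ≠ 0 := pow_ne_zero _ (norm_ne_zero_iff.2 hw)
  have key : ∀ i, v i * v j / ‖v‖ ^ 2 = w i * w j / ‖w‖ ^ 2 := fun i => congrFun (congrFun h i) j
  have hvj : v j ≠ 0 := by
    intro h0
    have := key j
    rw [h0] at this
    have h2 : w j * w j / ‖w‖ ^ 2 ≠ 0 := div_ne_zero (mul_ne_zero hj hj) hw'
    apply h2
    rw [← this]; simp
  rw [Projectivization.mk_eq_mk_iff']
  refine ⟨w j * ‖v‖ ^ 2 / (v j * ‖w‖ ^ 2), ?_⟩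
  ext i
  have := key i
  simp only [PiLp.smul_apply, smul_eq_mul]
  field_simp at this ⊢
  linarith

/-! ### Symmetric simplicial complexes and the cell structures they induce on projective space -/

theorem zpow_smul_mem_iff {V : Type} [DecidableEq V] {g : Equiv.Perm V} {F : Set (Finset V)}
    (h : ∀ σ, g • σ ∈ F ↔ σ ∈ F) (k : ℤ) (σ : Finset V) : g ^ k • σ ∈ F ↔ σ ∈ F := by
  induction k with
  | zero => simp
  | succ k ih => rw [add_comm, zpow_add, mul_smul, zpow_one, h, ih]
  | pred k ih =>
    rw [← h, ← mul_smul, ← zpow_one_add]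
    rw [show (1 + (-(k : ℤ) - 1)) = -k by ring, ih]

theorem support_equivMapDomain_eq_smul {V : Type} [DecidableEq V] (f : Equiv.Perm V)
    (t : V →₀ ℝ) : (t.equivMapDomain f).support = f • t.support := by
  ext x
  simp [Finset.mem_smul_finset, Finsupp.equivMapDomain_apply]
  constructor
  · intro hx
    exact ⟨_, hx, by simp⟩
  · rintro ⟨y, hy, rfl⟩
    simpa using hy

theorem sum_equivMapDomain {V : Type} (f : Equiv.Perm V) (t : V →₀ ℝ) :
    ((t.equivMapDomain f).sum fun _ r => r) = t.sum fun _ r => r := by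
  rw [Finsupp.equivMapDomain_eq_mapDomain, Finsupp.sum_mapDomain_index] <;> simp

/-- A simplicial complex on the vertex set `V`, invariant under a permutation `g`, together with
a map to `ℝ^(n+1)` that is odd with respect to `g` and meets each line through the origin in
exactly one `g`-orbit. -/
structure ProjectiveModel (V : Type) [DecidableEq V] (n : ℕ) where
  g : Equiv.Perm V
  faces : Set (Finset V)
  nonempty_of_mem : ∀ σ ∈ faces, σ.Nonempty
  mem_of_subset : ∀ σ ∈ faces, ∀ τ ⊆ σ, τ.Nonempty → τ ∈ faces
  smul_mem : ∀ σ, g • σ ∈ faces ↔ σ ∈ faces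
  exists_finite : ∃ T : Set (Finset V), T.Finite ∧ ∀ σ ∈ faces, ∃ k : ℤ, g ^ k • σ ∈ T
  rigid : ∀ σ ∈ faces, ∀ x ∈ σ, ∀ k : ℤ, (g ^ k) x ∈ σ → (g ^ k) x = x
  map : (V →₀ ℝ) → EuclideanSpace ℝ (Fin (n + 1))
  continuous_map : ∀ (m : ℕ) (e : Fin (m + 1) ↪ V), Finset.univ.map e ∈ faces →
    Continuous fun t : stdSimplex ℝ (Fin (m + 1)) => map (∑ i, Finsupp.single (e i) (t.1 i))
  map_ne_zero : ∀ t : V →₀ ℝ, (∀ v, 0 ≤ t v) → t.support ∈ faces → map t ≠ 0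
  map_odd : ∀ t : V →₀ ℝ, map (t.equivMapDomain g) = -map t
  map_surjective : ∀ P, P ≠ 0 → ∃ t : V →₀ ℝ, (∀ v, 0 ≤ t v) ∧ t.support ∈ faces ∧
    (t.sum fun _ r => r) = 1 ∧ ∃ c : ℝ, map t = c • P
  map_injective : ∀ t₁ t₂ : V →₀ ℝ, (∀ v, 0 ≤ t₁ v) → t₁.support ∈ faces →
    (t₁.sum fun _ r => r) = 1 → (∀ v, 0 ≤ t₂ v) → t₂.support ∈ faces →
    (t₂.sum fun _ r => r) = 1 → ∀ c : ℝ, map t₁ = c • map t₂ →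
    ∃ k : ℤ, t₂ = t₁.equivMapDomain (g ^ k)

namespace ProjectiveModel

/-- The combination of vertices with given barycentric coordinates. -/
noncomputable def combo {V : Type} {m : ℕ} (e : Fin (m + 1) ↪ V) (t : Fin (m + 1) → ℝ) : V →₀ ℝ :=
  ∑ i, Finsupp.single (e i) (t i)

theorem sum_combo {V : Type} {m : ℕ} (e : Fin (m + 1) ↪ V) (t : Fin (m + 1) → ℝ) :
    ((combo e t).sum fun _ r => r) = ∑ i, t i := by
  rw [combo, ← Finsupp.sum_finsetSum_index] <;> simp

variable {V : Type} [DecidableEq V] {n : ℕ} (M : ProjectiveModel V n)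

theorem map_equivMapDomain_zpow (k : ℤ) (t : V →₀ ℝ) :
    M.map (t.equivMapDomain (M.g ^ k)) = M.map t ∨ M.map (t.equivMapDomain (M.g ^ k)) = -M.map t := by
  have step : ∀ k : ℤ, M.map (t.equivMapDomain (M.g ^ (k + 1)))
      = -M.map (t.equivMapDomain (M.g ^ k)) := by
    intro k
    rw [← M.map_odd, ← Finsupp.equivMapDomain_trans]
    congr 2
    ext x
    simp [add_comm k 1, zpow_one_add]
  induction k with
  | zero =>
    left
    congr 1
    ext x
    rfl
  | succ k ih =>
    rw [step]
    rcases ih with h | h <;> rw [h] <;> simp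
  | pred k ih =>
    have := step (-(k : ℤ) - 1)
    rw [sub_add_cancel] at this
    rw [this, neg_inj, neg_eq_iff_eq_neg] at ih
    exact ih.symm

/-- `t` is a point of the polyhedron with carrier `σ`. -/
def IsPoint (σ : Finset V) (t : V →₀ ℝ) : Prop :=
  (∀ v, 0 ≤ t v) ∧ t.support = σ ∧ (t.sum fun _ r => r) = 1

theorem IsPoint.equivMapDomain {σ : Finset V} {t : V →₀ ℝ} (h : IsPoint σ t) (f : Equiv.Perm V) :
    IsPoint (f • σ) (t.equivMapDomain f) := by
  refine ⟨fun v => by simpa using h.1 _, ?_, ?_⟩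
  · rw [support_equivMapDomain_eq_smul, h.2.1]
  · rw [sum_equivMapDomain, h.2.2]

/-- The open cell of `P^n` with carrier `σ`. -/
def openCell (σ : Finset V) : Set (RealProjectiveSpace n) :=
  {P | ∃ t, IsPoint σ t ∧ ∃ h : M.map t ≠ 0, P = Projectivization.mk ℝ (M.map t) h}

theorem openCell_smul_subset (σ : Finset V) (k : ℤ) :
    M.openCell (M.g ^ k • σ) ⊆ M.openCell σ := by
  rintro P ⟨t, ht, h0, rfl⟩
  have key := M.map_equivMapDomain_zpow (-k) t
  have h0' : M.map (t.equivMapDomain (M.g ^ (-k))) ≠ 0 := by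
    rcases key with h | h <;> rw [h] <;> simpa using h0
  refine ⟨t.equivMapDomain (M.g ^ (-k)), ?_, h0', ?_⟩
  · simpa [← mul_smul] using ht.equivMapDomain (M.g ^ (-k))
  · rw [Projectivization.mk_eq_mk_iff']
    rcases key with h | h
    · exact ⟨1, by rw [h, one_smul]⟩
    · exact ⟨-1, by rw [h]; simp⟩

theorem openCell_smul (σ : Finset V) (k : ℤ) : M.openCell (M.g ^ k • σ) = M.openCell σ := by
  refine (M.openCell_smul_subset σ k).antisymm ?_
  simpa [← mul_smul] using M.openCell_smul_subset (M.g ^ k • σ) (-k)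

theorem exists_smul_eq_of_mem_openCell {σ τ : Finset V} (hσ : σ ∈ M.faces) (hτ : τ ∈ M.faces)
    {P : RealProjectiveSpace n} (h₁ : P ∈ M.openCell σ) (h₂ : P ∈ M.openCell τ) :
    ∃ k : ℤ, M.g ^ k • σ = τ := by
  obtain ⟨t, ht, h0, rfl⟩ := h₁
  obtain ⟨s, hs, h0', h⟩ := h₂
  rw [Projectivization.mk_eq_mk_iff'] at h
  obtain ⟨c, hc⟩ := h
  obtain ⟨k, hk⟩ := M.map_injective t s ht.1 (ht.2.1 ▸ hσ) ht.2.2 hs.1 (hs.2.1 ▸ hτ) hs.2.2 c hc.symm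
  refine ⟨k, ?_⟩
  rw [← (ht.equivMapDomain (M.g ^ k)).2.1, ← hk, hs.2.1]

theorem exists_mem_openCell (P : RealProjectiveSpace n) : ∃ σ ∈ M.faces, P ∈ M.openCell σ := by
  induction P using Projectivization.ind with | _ v hv
  obtain ⟨t, h1, h2, h3, c, hc⟩ := M.map_surjective v hv
  refine ⟨_, h2, t, ⟨h1, rfl, h3⟩, M.map_ne_zero t h1 h2, ?_⟩
  have hc0 : c ≠ 0 := by
    rintro rfl
    exact M.map_ne_zero t h1 h2 (by simpa using hc)
  rw [Projectivization.mk_eq_mk_iff']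
  exact ⟨c⁻¹, by rw [hc, smul_smul, inv_mul_cancel₀ hc0, one_smul]⟩

/-- Faces in the same `g`-orbit are identified. -/
def setoid : Setoid {σ // σ ∈ M.faces} where
  r σ τ := ∃ k : ℤ, M.g ^ k • σ.1 = τ.1
  iseqv :=
    { refl := fun σ => ⟨0, by simp⟩
      symm := by
        rintro σ τ ⟨k, hk⟩
        exact ⟨-k, by rw [← hk, ← mul_smul]; simp⟩
      trans := by
        rintro σ τ ρ ⟨k, hk⟩ ⟨l, hl⟩
        exact ⟨l + k, by rw [← hl, ← hk, ← mul_smul, zpow_add]⟩ }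

/-- The cells of the quotient complex. -/
def Cell : Type := Quotient M.setoid

/-- The orbit of a face. -/
def cell (σ : Finset V) (h : σ ∈ M.faces) : M.Cell := Quotient.mk M.setoid ⟨σ, h⟩

/-- A representative of a cell. -/
noncomputable def rep (c : M.Cell) : Finset V := (Quotient.out c).1

theorem rep_mem (c : M.Cell) : M.rep c ∈ M.faces := (Quotient.out c).2

theorem cell_rep (c : M.Cell) : M.cell (M.rep c) (M.rep_mem c) = c := Quotient.out_eq c

theorem cell_eq_cell_iff {σ τ : Finset V} (hσ : σ ∈ M.faces) (hτ : τ ∈ M.faces) :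
    M.cell σ hσ = M.cell τ hτ ↔ ∃ k : ℤ, M.g ^ k • σ = τ :=
  Quotient.eq (r := M.setoid)

theorem exists_smul_rep_cell {σ : Finset V} (hσ : σ ∈ M.faces) :
    ∃ k : ℤ, M.g ^ k • M.rep (M.cell σ hσ) = σ :=
  (M.cell_eq_cell_iff (M.rep_mem _) hσ).1 (M.cell_rep _)

instance : Finite M.Cell := by
  obtain ⟨T, hT, h⟩ := M.exists_finite
  have : Finite T := hT
  choose k hk using h
  refine Finite.of_injective
    (fun c : M.Cell => (⟨_, hk (M.rep c) (M.rep_mem c)⟩ : T)) ?_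
  intro c d hcd
  have hcd' : M.g ^ k (M.rep c) (M.rep_mem c) • M.rep c =
    M.g ^ k (M.rep d) (M.rep_mem d) • M.rep d := congrArg Subtype.val hcd
  rw [← M.cell_rep c, ← M.cell_rep d, cell_eq_cell_iff]
  refine ⟨-k (M.rep d) (M.rep_mem d) + k (M.rep c) (M.rep_mem c), ?_⟩
  rw [zpow_add, mul_smul, hcd', ← mul_smul]
  simp

/-- The dimension of a cell. -/
noncomputable def dim (c : M.Cell) : ℕ := (M.rep c).card - 1

theorem dim_add_one (c : M.Cell) : M.dim c + 1 = (M.rep c).card :=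
  Nat.sub_add_cancel (M.nonempty_of_mem _ (M.rep_mem c)).card_pos

theorem dim_cell {σ : Finset V} (hσ : σ ∈ M.faces) : M.dim (M.cell σ hσ) + 1 = σ.card := by
  obtain ⟨k, hk⟩ := M.exists_smul_rep_cell hσ
  rw [dim_add_one]
  conv_rhs => rw [← hk, Finset.card_smul_finset]

/-- An enumeration of the vertices of a cell. -/
noncomputable def vert (c : M.Cell) : Fin (M.dim c + 1) ↪ V :=
  ((Finset.equivFinOfCardEq (M.dim_add_one c).symm).symm.toEmbedding).trans
    (Function.Embedding.subtype _)

theorem univ_map_vert (c : M.Cell) : Finset.univ.map (M.vert c) = M.rep c := by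
  ext x
  simp only [vert, Finset.mem_map, Finset.mem_univ, true_and]
  constructor
  · rintro ⟨i, rfl⟩
    simp
  · intro hx
    exact ⟨Finset.equivFinOfCardEq (M.dim_add_one c).symm ⟨x, hx⟩, by simp⟩

theorem combo_apply {m : ℕ} (e : Fin (m + 1) ↪ V) (t : Fin (m + 1) → ℝ) (i : Fin (m + 1)) :
    combo e t (e i) = t i := by
  simp [combo, Finsupp.finsetSum_apply, Finsupp.single_apply]

theorem combo_apply_of_notMem {m : ℕ} (e : Fin (m + 1) ↪ V) (t : Fin (m + 1) → ℝ) {x : V}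
    (hx : x ∉ Finset.univ.map e) : combo e t x = 0 := by
  simp only [combo, Finsupp.finsetSum_apply, Finsupp.single_apply]
  refine Finset.sum_eq_zero fun i _ => if_neg ?_
  rintro rfl
  exact hx (by simp)

theorem isPoint_combo {m : ℕ} (e : Fin (m + 1) ↪ V) (t : stdSimplex ℝ (Fin (m + 1)))
    (S : Finset (Fin (m + 1))) (ht : t ∈ simplexOpenFace S) : IsPoint (S.map e) (combo e t.1) := by
  refine ⟨fun v => ?_, ?_, ?_⟩
  · by_cases hv : v ∈ Finset.univ.map e
    · obtain ⟨i, -, rfl⟩ := Finset.mem_map.1 hv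
      rw [combo_apply]; exact t.2.1 i
    · rw [combo_apply_of_notMem e _ hv]
  · ext v
    rw [Finsupp.mem_support_iff]
    by_cases hv : v ∈ Finset.univ.map e
    · obtain ⟨i, -, rfl⟩ := Finset.mem_map.1 hv
      rw [combo_apply, Finset.mem_map' e, ← ht i]
      exact ⟨fun h => lt_of_le_of_ne (t.2.1 i) (Ne.symm h), fun h => h.ne'⟩
    · rw [combo_apply_of_notMem e _ hv]
      simp only [ne_eq, not_true_eq_false, false_iff]
      exact fun h => hv (Finset.map_subset_map.2 (Finset.subset_univ _) h)
  · rw [sum_combo]; exact t.2.2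

theorem exists_combo_eq {m : ℕ} (e : Fin (m + 1) ↪ V) (S : Finset (Fin (m + 1))) (s : V →₀ ℝ)
    (hs : IsPoint (S.map e) s) :
    ∃ t : stdSimplex ℝ (Fin (m + 1)), t ∈ simplexOpenFace S ∧ combo e t.1 = s := by
  have hc : combo e (fun i => s (e i)) = s := by
    ext x
    by_cases hx : x ∈ Finset.univ.map e
    · obtain ⟨i, -, rfl⟩ := Finset.mem_map.1 hx
      rw [combo_apply]
    · rw [combo_apply_of_notMem e _ hx]
      by_contra h
      have : x ∈ S.map e := by rw [← hs.2.1]; exact Finsupp.mem_support_iff.2 (Ne.symm h)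
      exact hx (Finset.map_subset_map.2 (Finset.subset_univ _) this)
  refine ⟨⟨fun i => s (e i), fun i => hs.1 _, ?_⟩, ?_, hc⟩
  · rw [← sum_combo e, hc, hs.2.2]
  · intro i
    change 0 < s (e i) ↔ _
    rw [← Finset.mem_map' e, ← hs.2.1, Finsupp.mem_support_iff]
    exact ⟨fun h => h.ne', fun h => lt_of_le_of_ne (hs.1 _) (Ne.symm h)⟩

theorem exists_mem_simplexOpenFace {m : ℕ} (t : stdSimplex ℝ (Fin (m + 1))) :
    ∃ S : Finset (Fin (m + 1)), S.Nonempty ∧ t ∈ simplexOpenFace S := by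
  refine ⟨Finset.univ.filter fun i => 0 < t.1 i, ?_, fun i => by simp⟩
  by_contra h
  rw [Finset.not_nonempty_iff_eq_empty, Finset.filter_eq_empty_iff] at h
  have h1 : ∑ i, t.1 i = 0 := Finset.sum_eq_zero fun i hi => le_antisymm (not_lt.1 (h hi)) (t.2.1 i)
  have h2 : ∑ i, t.1 i = 1 := t.2.2
  linarith

theorem map_vert_mem (c : M.Cell) {S : Finset (Fin (M.dim c + 1))} (hS : S.Nonempty) :
    S.map (M.vert c) ∈ M.faces :=
  M.mem_of_subset _ (M.rep_mem c) _
    (by rw [← univ_map_vert]; exact Finset.map_subset_map.2 (Finset.subset_univ _)) (hS.map)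

theorem map_combo_ne_zero (c : M.Cell) (t : stdSimplex ℝ (Fin (M.dim c + 1))) :
    M.map (combo (M.vert c) t.1) ≠ 0 := by
  obtain ⟨S, hS, ht⟩ := exists_mem_simplexOpenFace t
  have h := isPoint_combo (M.vert c) t S ht
  exact M.map_ne_zero _ h.1 (h.2.1 ▸ M.map_vert_mem c hS)

/-- The characteristic map of a cell. -/
noncomputable def charMap (c : M.Cell) (t : stdSimplex ℝ (Fin (M.dim c + 1))) :
    RealProjectiveSpace n :=
  Projectivization.mk ℝ (M.map (combo (M.vert c) t.1)) (M.map_combo_ne_zero c t)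

theorem charMap_image_simplexOpenFace (c : M.Cell) (S : Finset (Fin (M.dim c + 1))) :
    M.charMap c '' simplexOpenFace S = M.openCell (S.map (M.vert c)) := by
  ext P
  constructor
  · rintro ⟨t, ht, rfl⟩
    exact ⟨_, isPoint_combo _ t S ht, M.map_combo_ne_zero c t, rfl⟩
  · rintro ⟨s, hs, h0, rfl⟩
    obtain ⟨t, ht, rfl⟩ := exists_combo_eq _ S s hs
    exact ⟨t, ht, rfl⟩

theorem charMap_image_interior (c : M.Cell) :
    M.charMap c '' simplexOpenFace Finset.univ = M.openCell (M.rep c) := by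
  rw [charMap_image_simplexOpenFace, univ_map_vert]

theorem openCell_rep_cell {σ : Finset V} (hσ : σ ∈ M.faces) :
    M.openCell (M.rep (M.cell σ hσ)) = M.openCell σ := by
  obtain ⟨k, hk⟩ := M.exists_smul_rep_cell hσ
  conv_rhs => rw [← hk, openCell_smul]

/-- Two points with the same image differ by some `g ^ k`. By `rigid` this power fixes every vertex
that carries weight in the first point, even if it is not the identity. So the first point is
dominated coordinatewise by the second, and both have total weight 1. -/
theorem charMap_injective (c : M.Cell) : Function.Injective (M.charMap c) := by
  intro s t h
  obtain ⟨S, hS, hs⟩ := exists_mem_simplexOpenFace s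
  obtain ⟨T, hT, ht⟩ := exists_mem_simplexOpenFace t
  have h1 := isPoint_combo (M.vert c) s S hs
  have h2 := isPoint_combo (M.vert c) t T ht
  obtain ⟨a, ha⟩ := (Projectivization.mk_eq_mk_iff' _ _ _ _ _).1 h
  obtain ⟨k, hk⟩ := M.map_injective _ _ h1.1 (h1.2.1 ▸ M.map_vert_mem c hS) h1.2.2
    h2.1 (h2.2.1 ▸ M.map_vert_mem c hT) h2.2.2 a ha.symm
  have hsub : ∀ S : Finset (Fin (M.dim c + 1)), S.map (M.vert c) ⊆ M.rep c := fun S => by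
    rw [← univ_map_vert]; exact Finset.map_subset_map.2 (Finset.subset_univ _)
  have hle : ∀ v, combo (M.vert c) s.1 v ≤ combo (M.vert c) t.1 v := by
    intro v
    by_cases hv : combo (M.vert c) s.1 v = 0
    · rw [hv]; exact h2.1 v
    · have hval : combo (M.vert c) t.1 ((M.g ^ k) v) = combo (M.vert c) s.1 v := by
        rw [hk, Finsupp.equivMapDomain_apply, Equiv.symm_apply_apply]
      have hv1 : v ∈ M.rep c := hsub S (h1.2.1 ▸ Finsupp.mem_support_iff.2 hv)
      have hv2 : (M.g ^ k) v ∈ M.rep c :=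
        hsub T (h2.2.1 ▸ Finsupp.mem_support_iff.2 (hval ▸ hv))
      rw [M.rigid _ (M.rep_mem c) v hv1 k hv2] at hval
      exact hval.ge
  have hle' : ∀ i, s.1 i ≤ t.1 i := fun i => by simpa [combo_apply] using hle (M.vert c i)
  have hsum : ∑ i, s.1 i = ∑ i, t.1 i := s.2.2.trans t.2.2.symm
  ext i
  exact (Finset.sum_eq_sum_iff_of_le fun i _ => hle' i).1 hsum i (Finset.mem_univ i)

/-- The cell structure on `P^n` defined by a projective model. -/
noncomputable def complex : GeneralizedSimplicialComplex where
  Polyhedron := RealProjectiveSpace n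
  topology := inferInstance
  hausdorff := inferInstance
  Cell := M.Cell
  finite_cell := inferInstance
  dim := M.dim
  charMap := M.charMap
  continuous_charMap c := by
    have h := M.continuous_map _ (M.vert c) (by rw [univ_map_vert]; exact M.rep_mem c)
    exact continuous_coinduced_rng.comp (h.subtype_mk fun t => M.map_combo_ne_zero c t)
  injective_charMap := M.charMap_injective
  exists_face c S hS := by
    refine ⟨M.cell _ (M.map_vert_mem c hS), ?_, ?_⟩
    · rw [dim_cell, Finset.card_map]
    · rw [charMap_image_interior, charMap_image_simplexOpenFace, openCell_rep_cell]
  existsUnique_cell P := by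
    obtain ⟨σ, hσ, hP⟩ := M.exists_mem_openCell P
    refine ⟨M.cell σ hσ, ?_, fun d hd => ?_⟩
    · simpa only [charMap_image_interior, openCell_rep_cell] using hP
    · simp only [charMap_image_interior] at hd
      rw [← M.cell_rep d, cell_eq_cell_iff]
      exact M.exists_smul_eq_of_mem_openCell (M.rep_mem d) hσ hd hP

/-! ### The face relation in the quotient, and its vertices -/

/-- A closed cell is the union of the open cells of the nonempty subsets of its representative, and
open cells meet only within an orbit. Hence a single interior point decides whether one closed cell
lies in another. -/
theorem isFace_iff (c d : M.Cell) :
    M.complex.IsFace c d ↔ ∃ k : ℤ, M.g ^ k • M.rep c ⊆ M.rep d := by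
  have key : ∀ d : M.Cell, ∀ P, P ∈ Set.range (M.charMap d) ↔
      ∃ τ ⊆ M.rep d, τ.Nonempty ∧ P ∈ M.openCell τ := by
    intro d P
    constructor
    · rintro ⟨t, rfl⟩
      obtain ⟨S, hS, ht⟩ := exists_mem_simplexOpenFace t
      refine ⟨S.map (M.vert d), ?_, hS.map, ?_⟩
      · rw [← univ_map_vert]; exact Finset.map_subset_map.2 (Finset.subset_univ _)
      · rw [← charMap_image_simplexOpenFace]
        exact ⟨t, ht, rfl⟩
    · rintro ⟨τ, hτ, hne, hP⟩
      rw [← univ_map_vert] at hτ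
      obtain ⟨S, -, rfl⟩ := Finset.subset_map_iff.1 hτ
      rw [← charMap_image_simplexOpenFace] at hP
      obtain ⟨t, -, rfl⟩ := hP
      exact ⟨t, rfl⟩
  constructor
  · intro h
    obtain ⟨P, hP, -⟩ : ∃ P, P ∈ M.openCell (M.rep c) ∧ True := by
      rw [← charMap_image_interior]
      have hpos : (0 : ℝ) < (M.dim c + 1 : ℕ) := by positivity
      -- The barycentre serves as the interior point.
      refine ⟨_, ⟨⟨fun _ => ((M.dim c + 1 : ℕ) : ℝ)⁻¹, fun i => by positivity, ?_⟩, ?_, rfl⟩, trivial⟩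
      · rw [Finset.sum_const, Finset.card_univ, Fintype.card_fin, nsmul_eq_mul,
          mul_inv_cancel₀ hpos.ne']
      · intro i
        simpa using by positivity
    have hP' : P ∈ Set.range (M.charMap d) :=
      h ((key c P).2 ⟨_, subset_rfl, M.nonempty_of_mem _ (M.rep_mem c), hP⟩)
    obtain ⟨τ, hτ, hne, hP2⟩ := (key d P).1 hP'
    obtain ⟨k, hk⟩ := M.exists_smul_eq_of_mem_openCell (M.rep_mem c)
      (M.mem_of_subset _ (M.rep_mem d) τ hτ hne) hP hP2
    exact ⟨k, hk ▸ hτ⟩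
  · rintro ⟨k, hk⟩ P hP
    obtain ⟨τ, hτ, hne, hP⟩ := (key c P).1 hP
    refine (key d P).2 ⟨M.g ^ k • τ, ?_, hne.smul_finset, ?_⟩
    · exact (Finset.smul_finset_subset_smul_finset hτ).trans hk
    · rwa [openCell_smul]

theorem isFace_cell_iff {σ τ : Finset V} (hσ : σ ∈ M.faces) (hτ : τ ∈ M.faces) :
    M.complex.IsFace (M.cell σ hσ) (M.cell τ hτ) ↔ ∃ k : ℤ, M.g ^ k • σ ⊆ τ := by
  obtain ⟨a, ha⟩ := M.exists_smul_rep_cell hσ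
  obtain ⟨b, hb⟩ := M.exists_smul_rep_cell hτ
  rw [M.isFace_iff]
  constructor
  · rintro ⟨k, hk⟩
    refine ⟨b + k - a, ?_⟩
    have := Finset.smul_finset_subset_smul_finset (a := M.g ^ b) hk
    rw [hb] at this
    rw [← ha, ← mul_smul, ← zpow_add, sub_add_cancel, zpow_add, mul_smul]
    exact this
  · rintro ⟨k, hk⟩
    refine ⟨-b + k + a, ?_⟩
    have := Finset.smul_finset_subset_smul_finset (a := M.g ^ (-b)) hk
    rw [zpow_add, zpow_add, mul_smul, mul_smul, ha]
    refine this.trans ?_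
    conv_lhs => rw [← hb]
    rw [← mul_smul, ← zpow_add]
    simp

/-- The orbit of a single vertex. -/
def vertexOf (x : V) (h : {x} ∈ M.faces) : M.complex.Vertex :=
  ⟨M.cell {x} h, Nat.succ_injective (M.dim_cell h)⟩

theorem vertexOf_eq_iff {x y : V} (hx : {x} ∈ M.faces) (hy : {y} ∈ M.faces) :
    M.vertexOf x hx = M.vertexOf y hy ↔ M.g.SameCycle x y := by
  rw [← Subtype.coe_inj]
  refine (M.cell_eq_cell_iff hx hy).trans ?_
  simp [Equiv.Perm.SameCycle, Finset.smul_finset_singleton]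

theorem exists_vertexOf (v : M.complex.Vertex) : ∃ x h, v = M.vertexOf x h := by
  have h1 : (M.rep v.1).card = 1 :=
    (M.dim_add_one v.1).symm.trans (congrArg (· + 1) v.2)
  obtain ⟨x, hx⟩ := Finset.card_eq_one.1 h1
  refine ⟨x, hx ▸ M.rep_mem v.1, Subtype.ext ?_⟩
  refine (M.cell_rep v.1).symm.trans ?_
  change M.cell _ _ = M.cell _ _
  congr 1

theorem vertexOf_isFace_cell_iff {x : V} {σ : Finset V} (hx : {x} ∈ M.faces) (hσ : σ ∈ M.faces) :
    M.complex.IsFace (M.vertexOf x hx).1 (M.cell σ hσ) ↔ ∃ y ∈ σ, M.g.SameCycle x y := by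
  refine (M.isFace_cell_iff hx hσ).trans ?_
  simp only [Finset.smul_finset_singleton, Finset.singleton_subset_iff, Equiv.Perm.smul_def]
  exact ⟨fun ⟨k, hk⟩ => ⟨_, hk, k, rfl⟩, fun ⟨y, hy, k, hk⟩ => ⟨k, hk ▸ hy⟩⟩

theorem eq_of_sameCycle {σ : Finset V} (hσ : σ ∈ M.faces) {x y : V} (hx : x ∈ σ) (hy : y ∈ σ)
    (h : M.g.SameCycle x y) : x = y := by
  obtain ⟨k, rfl⟩ := h
  exact (M.rigid σ hσ x hx k hy).symm

/-! ### The quadrangulation defined by a two-colouring -/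

/-- The orbits of the edges with ends of different colours. -/
def bichromaticEdges (color : V → Bool) : Set M.complex.Edge :=
  {e | ∃ x y, color x ≠ color y ∧ ∃ h : {x, y} ∈ M.faces, e.1 = M.cell {x, y} h}

theorem joins_cell {x y u v : V} (hxy : {x, y} ∈ M.faces) (hu : {u} ∈ M.faces)
    (hv : {v} ∈ M.faces) {e : M.complex.Edge} (he : e.1 = M.cell {x, y} hxy)
    (h : M.complex.Joins e (M.vertexOf u hu) (M.vertexOf v hv)) :
    M.g.SameCycle u x ∧ M.g.SameCycle v y ∨ M.g.SameCycle u y ∧ M.g.SameCycle v x := by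
  obtain ⟨hne, h1, h2⟩ := h
  rw [he] at h1 h2
  obtain ⟨a, ha, h3⟩ := (M.vertexOf_isFace_cell_iff _ _).1 h1
  obtain ⟨b, hb, h4⟩ := (M.vertexOf_isFace_cell_iff _ _).1 h2
  rw [Ne, vertexOf_eq_iff] at hne
  simp only [Finset.mem_insert, Finset.mem_singleton] at ha hb
  rcases ha with rfl | rfl <;> rcases hb with rfl | rfl
  · exact (hne (h3.trans h4.symm)).elim
  · exact .inl ⟨h3, h4⟩
  · exact .inr ⟨h3, h4⟩
  · exact (hne (h3.trans h4.symm)).elim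

theorem exists_bichromatic_edge {color : V → Bool} {x y : V} (hxy : {x, y} ∈ M.faces)
    (hc : color x ≠ color y) :
    ∃ e ∈ M.bichromaticEdges color, e.1 = M.cell {x, y} hxy := by
  have hne : x ≠ y := by rintro rfl; exact hc rfl
  refine ⟨⟨M.cell {x, y} hxy, ?_⟩, ⟨x, y, hc, hxy, rfl⟩, rfl⟩
  have := M.dim_cell hxy
  rw [Finset.card_pair hne] at this
  exact Nat.succ_injective this

theorem joins_of_mem {x y : V} (hxy : {x, y} ∈ M.faces) (hne : x ≠ y) (hx : {x} ∈ M.faces)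
    (hy : {y} ∈ M.faces) {e : M.complex.Edge} (he : e.1 = M.cell {x, y} hxy) :
    M.complex.Joins e (M.vertexOf x hx) (M.vertexOf y hy) := by
  refine ⟨?_, ?_, ?_⟩
  · rw [Ne, vertexOf_eq_iff]
    exact fun h => hne (M.eq_of_sameCycle hxy (by simp) (by simp) h)
  · rw [he, vertexOf_isFace_cell_iff]
    exact ⟨x, by simp, .refl _ _⟩
  · rw [he, vertexOf_isFace_cell_iff]
    exact ⟨y, by simp, .refl _ _⟩

theorem color_zpow {color : V → Bool} (hcolor : ∀ x, color (M.g x) = !color x) (k : ℤ) (x y : V) :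
    color ((M.g ^ k) x) = color ((M.g ^ k) y) ↔ color x = color y := by
  induction k with
  | zero => simp
  | succ k ih =>
    rw [add_comm, zpow_one_add, Equiv.Perm.mul_apply, Equiv.Perm.mul_apply, hcolor, hcolor, ← ih]
    simp
  | pred k ih =>
    rw [← ih, show (-(k : ℤ)) = 1 + (-k - 1) by ring, zpow_one_add, Equiv.Perm.mul_apply,
      Equiv.Perm.mul_apply, hcolor, hcolor]
    simp

theorem singleton_mem {σ : Finset V} (hσ : σ ∈ M.faces) {x : V} (hx : x ∈ σ) : {x} ∈ M.faces :=
  M.mem_of_subset σ hσ _ (by simpa using hx) (by simp)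

theorem pair_mem {σ : Finset V} (hσ : σ ∈ M.faces) {x y : V} (hx : x ∈ σ) (hy : y ∈ σ) :
    {x, y} ∈ M.faces :=
  M.mem_of_subset σ hσ _ (by simp [Finset.insert_subset_iff, hx, hy]) (by simp)

theorem exists_color_ne {color : V → Bool}
    (hmix : ∀ σ ∈ M.faces, (∀ x ∈ σ, ∀ y ∈ σ, color x = color y) → ∃ w ∉ σ, insert w σ ∈ M.faces)
    {c : M.Cell} (hc : M.complex.IsMaximal c) :
    ∃ x ∈ M.rep c, ∃ y ∈ M.rep c, color x ≠ color y := by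
  by_contra! h
  obtain ⟨w, hw, hins⟩ := hmix _ (M.rep_mem c) h
  have h1 : M.complex.IsFace c (M.cell _ hins) := by
    conv_lhs => rw [← M.cell_rep c]
    rw [isFace_cell_iff]
    exact ⟨0, by simp⟩
  have h2 := congrArg M.dim (hc _ h1)
  have h3 := M.dim_cell hins
  have h4 := M.dim_add_one c
  rw [Finset.card_insert_of_notMem hw] at h3
  omega

/-- The parts are the colour classes of the chosen representative. They are well defined up to
exchange, since a power of `g` keeps all colours or flips all of them. Each orbit of vertices meets
the representative at most once. -/
theorem isCompleteBipartite_inducedGraph {color : V → Bool}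
    (hcolor : ∀ x, color (M.g x) = !color x) (c : M.Cell) :
    IsCompleteBipartiteGraph (M.complex.inducedGraph (M.bichromaticEdges color) c) := by
  have hrep : ∀ u : {v : M.complex.Vertex // M.complex.IsFace v.1 c},
      ∃ x, ∃ hx : x ∈ M.rep c, u.1 = M.vertexOf x (M.singleton_mem (M.rep_mem c) hx) := by
    rintro ⟨u, hu⟩
    obtain ⟨y, hy, rfl⟩ := M.exists_vertexOf u
    rw [← M.cell_rep c, vertexOf_isFace_cell_iff] at hu
    obtain ⟨x, hx, h⟩ := hu
    exact ⟨x, hx, (M.vertexOf_eq_iff _ _).2 h⟩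
  choose f hf hfu using hrep
  refine ⟨{u | color (f u) = true}, fun u v => ?_⟩
  have key : (M.complex.inducedGraph (M.bichromaticEdges color) c).Adj u v ↔
      color (f u) ≠ color (f v) := by
    constructor
    · rintro ⟨e, ⟨x, y, hxy, hface, he⟩, hec, hj⟩
      rw [hfu u, hfu v] at hj
      rw [he, ← M.cell_rep c, isFace_cell_iff] at hec
      obtain ⟨k, hk⟩ := hec
      have hkx : (M.g ^ k) x ∈ M.rep c := hk (Finset.mem_smul_finset.2 ⟨x, by simp, rfl⟩)
      have hky : (M.g ^ k) y ∈ M.rep c := hk (Finset.mem_smul_finset.2 ⟨y, by simp, rfl⟩)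
      rw [Ne, ← M.color_zpow hcolor k] at hxy
      rcases M.joins_cell hface _ _ he hj with ⟨h1, h2⟩ | ⟨h1, h2⟩
      · rw [M.eq_of_sameCycle (M.rep_mem c) (hf u) hkx (h1.trans ⟨k, rfl⟩),
          M.eq_of_sameCycle (M.rep_mem c) (hf v) hky (h2.trans ⟨k, rfl⟩)]
        exact hxy
      · rw [M.eq_of_sameCycle (M.rep_mem c) (hf u) hky (h1.trans ⟨k, rfl⟩),
          M.eq_of_sameCycle (M.rep_mem c) (hf v) hkx (h2.trans ⟨k, rfl⟩)]
        exact Ne.symm hxy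
    · intro h
      have hface := M.pair_mem (M.rep_mem c) (hf u) (hf v)
      obtain ⟨e, he, hee⟩ := M.exists_bichromatic_edge hface h
      refine ⟨e, he, ?_, ?_⟩
      · rw [hee]
        conv_rhs => rw [← M.cell_rep c]
        rw [isFace_cell_iff]
        exact ⟨0, by simp [Finset.insert_subset_iff, hf]⟩
      · rw [hfu u, hfu v]
        exact M.joins_of_mem hface (fun h' => h (congrArg color h')) _ _ hee
  rw [key]
  simp only [Set.mem_ofPred_eq]
  cases color (f u) <;> cases color (f v) <;> simp

theorem bichromaticEdges_simple {color : V → Bool} (hcolor : ∀ x, color (M.g x) = !color x)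
    (hsimple : ∀ x y x' y', {x, y} ∈ M.faces → {x', y'} ∈ M.faces → color x ≠ color y →
      color x' ≠ color y' → color x = color x' → M.g.SameCycle x x' → M.g.SameCycle y y' →
      ∃ k : ℤ, (M.g ^ k) x = x' ∧ (M.g ^ k) y = y')
    {e f : M.complex.Edge} (he : e ∈ M.bichromaticEdges color)
    (hf : f ∈ M.bichromaticEdges color) {u v : M.complex.Vertex} (hej : M.complex.Joins e u v)
    (hfj : M.complex.Joins f u v) : e = f := by
  obtain ⟨u, hu, rfl⟩ := M.exists_vertexOf u
  obtain ⟨v, hv, rfl⟩ := M.exists_vertexOf v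
  have aux : ∀ {e : M.complex.Edge}, e ∈ M.bichromaticEdges color →
      M.complex.Joins e (M.vertexOf u hu) (M.vertexOf v hv) → ∃ x y, color x = true ∧
        color y = false ∧ M.g.SameCycle u x ∧ M.g.SameCycle v y ∧
        ∃ h : {x, y} ∈ M.faces, e.1 = M.cell {x, y} h := by
    rintro e ⟨x, y, hxy, hface, he⟩ hj
    obtain ⟨x, y, hxy, ⟨hface, he⟩, h1, h2⟩ : ∃ x y, color x ≠ color y ∧ (∃ h : ({x, y} : Finset V) ∈ M.faces,
        e.1 = M.cell {x, y} h) ∧ M.g.SameCycle u x ∧ M.g.SameCycle v y := by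
      rcases M.joins_cell hface hu hv he hj with ⟨h1, h2⟩ | ⟨h1, h2⟩
      · exact ⟨x, y, hxy, ⟨hface, he⟩, h1, h2⟩
      · refine ⟨y, x, hxy.symm, ⟨Finset.pair_comm x y ▸ hface, ?_⟩, h1, h2⟩
        exact he.trans ((M.cell_eq_cell_iff _ _).2 ⟨0, by simp [Finset.pair_comm]⟩)
    cases hcx : color x with
    | true =>
      refine ⟨x, y, hcx, ?_, h1, h2, hface, he⟩
      rw [hcx] at hxy
      simpa using hxy.symm
    | false =>
      -- Applying `g` once flips both colours and stays in the same orbit, so the end in the orbit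
      -- of `u` may be assumed to have colour true.
      have hg : M.g • ({x, y} : Finset V) = {M.g x, M.g y} := by
        ext; simp [Finset.mem_smul_finset, eq_comm]
      have hface' : {M.g x, M.g y} ∈ M.faces := by rw [← hg, M.smul_mem]; exact hface
      refine ⟨M.g x, M.g y, by simp [hcolor, hcx], ?_, h1.trans ⟨1, rfl⟩, h2.trans ⟨1, rfl⟩,
        hface', ?_⟩
      · rw [hcx] at hxy
        rw [hcolor]
        simpa using hxy.symm
      · exact he.trans ((M.cell_eq_cell_iff _ _).2 ⟨1, by rw [zpow_one, hg]⟩)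
  obtain ⟨x, y, hx, hy, hux, hvy, hface, he⟩ := aux he hej
  obtain ⟨x', y', hx', hy', hux', hvy', hface', hf⟩ := aux hf hfj
  obtain ⟨k, rfl, rfl⟩ := hsimple x y x' y' hface hface' (by simp [hx, hy]) (by simp [hx', hy'])
    (by rw [hx, hx']) (hux.symm.trans hux') (hvy.symm.trans hvy')
  refine Subtype.ext (he.trans (Eq.trans ((M.cell_eq_cell_iff _ _).2 ⟨k, ?_⟩) hf.symm))
  ext; simp [Finset.mem_smul_finset, eq_comm]

/-- `hmix` prevents monochromatic maximal cells, `hsimple` prevents parallel bichromatic edges in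
the quotient, and `hcomplete` makes any two orbits of vertices adjacent; `ι` selects one vertex from
each orbit. -/
theorem embedsAsQuadrangulation_top (color : V → Bool) (hcolor : ∀ x, color (M.g x) = !color x)
    (hmix : ∀ σ ∈ M.faces, (∀ x ∈ σ, ∀ y ∈ σ, color x = color y) → ∃ w ∉ σ, insert w σ ∈ M.faces)
    (hsimple : ∀ x y x' y', {x, y} ∈ M.faces → {x', y'} ∈ M.faces → color x ≠ color y →
      color x' ≠ color y' → color x = color x' → M.g.SameCycle x x' → M.g.SameCycle y y' →
      ∃ k : ℤ, (M.g ^ k) x = x' ∧ (M.g ^ k) y = y')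
    (hcomplete : ∀ x y, ¬ M.g.SameCycle x y →
      ∃ y', M.g.SameCycle y y' ∧ color x ≠ color y' ∧ {x, y'} ∈ M.faces)
    {W : Type*} (ι : W → V) (hvert : ∀ v : V, {v} ∈ M.faces)
    (hι : ∀ v : V, ∃! w, M.g.SameCycle (ι w) v) :
    EmbedsAsQuadrangulation (⊤ : SimpleGraph W) (RealProjectiveSpace n) := by
  refine ⟨M.complex, ⟨Homeomorph.refl _⟩, M.bichromaticEdges color, ⟨?_, ?_, ?_⟩, ?_⟩
  · exact fun e he f hf u v hej hfj => M.bichromaticEdges_simple hcolor hsimple he hf hej hfj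
  · exact fun c _ => M.isCompleteBipartite_inducedGraph hcolor c
  · intro c hc
    obtain ⟨x, hx, y, hy, hxy⟩ := M.exists_color_ne hmix hc
    obtain ⟨e, he, hee⟩ := M.exists_bichromatic_edge (M.pair_mem (M.rep_mem c) hx hy) hxy
    refine ⟨e, he, ?_⟩
    rw [hee]
    conv_rhs => rw [← M.cell_rep c]
    rw [isFace_cell_iff]
    exact ⟨0, by simp [Finset.insert_subset_iff, hx, hy]⟩
  · have hbij : Function.Bijective fun w => M.vertexOf (ι w) (hvert _) := by
      constructor
      · intro w w' h
        exact (hι (ι w')).unique ((M.vertexOf_eq_iff _ _).1 h) (.refl _ _)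
      · intro v
        obtain ⟨x, hx, rfl⟩ := M.exists_vertexOf v
        obtain ⟨w, hw, -⟩ := hι x
        exact ⟨w, (M.vertexOf_eq_iff _ _).2 hw⟩
    refine ⟨⟨Equiv.ofBijective _ hbij, ?_⟩⟩
    intro w w'
    simp only [Equiv.ofBijective_apply, SimpleGraph.top_adj]
    constructor
    · rintro ⟨e, -, hne, -⟩ rfl
      exact hne rfl
    · intro h
      have hne : ¬ M.g.SameCycle (ι w) (ι w') := fun h' =>
        h ((hι (ι w')).unique h' (.refl _ _))
      obtain ⟨y, hy, hc, hface⟩ := hcomplete _ _ hne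
      obtain ⟨e, he, hee⟩ := M.exists_bichromatic_edge hface hc
      refine ⟨e, he, ?_⟩
      rw [(M.vertexOf_eq_iff (hvert _) (hvert y)).2 hy]
      exact M.joins_of_mem hface (fun h' => hc (congrArg color h')) _ _ hee

end ProjectiveModel

/-! ### Combinatorics of the unrolled double cycle -/

namespace DoubleCycle

/-- Two cycles unrolled to `ℤ`, one for each colour, and, for each colour, an apex
`(c, inr false)` and a pole `(c, inr true)`. -/
abbrev Vert : Type := Bool × (ℤ ⊕ Bool)

/-- The lift of the antipodal map; its square is the shift by `-n`. -/
def antipode (n : ℤ) : Equiv.Perm Vert where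
  toFun
    | (true, .inl i) => (false, .inl i)
    | (false, .inl i) => (true, .inl (i - n))
    | (c, .inr z) => (!c, .inr z)
  invFun
    | (false, .inl i) => (true, .inl i)
    | (true, .inl i) => (false, .inl (i + n))
    | (c, .inr z) => (!c, .inr z)
  left_inv := by rintro ⟨_ | _, _ | _⟩ <;> simp
  right_inv := by rintro ⟨_ | _, _ | _⟩ <;> simp

variable (n : ℤ)

@[simp] theorem antipode_true (i : ℤ) : antipode n (true, .inl i) = (false, .inl i) := rfl

@[simp] theorem antipode_false (i : ℤ) : antipode n (false, .inl i) = (true, .inl (i - n)) := rfl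

@[simp] theorem antipode_inr (c : Bool) (z : Bool) :
    antipode n (c, .inr z) = (!c, .inr z) := by cases c <;> rfl

@[simp] theorem antipode_symm_true (i : ℤ) :
    (antipode n).symm (true, .inl i) = (false, .inl (i + n)) := rfl

@[simp] theorem antipode_symm_false (i : ℤ) :
    (antipode n).symm (false, .inl i) = (true, .inl i) := rfl

@[simp] theorem antipode_symm_inr (c : Bool) (z : Bool) :
    (antipode n).symm (c, .inr z) = (!c, .inr z) := by cases c <;> rfl

theorem antipode_fst (x : Vert) : (antipode n x).1 = !x.1 := by
  obtain ⟨_ | _, _ | _⟩ := x <;> simp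

theorem antipode_zpow_even_inl (l : ℤ) (c : Bool) (i : ℤ) :
    (antipode n ^ (2 * l)) (c, .inl i) = (c, .inl (i - l * n)) := by
  have h2 : ∀ c i, (antipode n ^ (2 : ℤ)) (c, .inl i) = (c, .inl (i - n)) := by
    rintro (_ | _) i <;> rfl
  have h2' : ∀ c i, (antipode n ^ (2 : ℤ))⁻¹ (c, .inl i) = (c, .inl (i + n)) := by
    intro c i
    rw [Equiv.Perm.inv_eq_iff_eq, h2]; simp
  rw [zpow_mul]
  induction l with
  | zero => simp
  | succ k ih =>
    rw [add_comm, zpow_one_add, Equiv.Perm.mul_apply, ih, h2]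
    congr 2; ring
  | pred k ih =>
    rw [show (-(k : ℤ) - 1) = -1 + -k by ring, zpow_add, zpow_neg_one, Equiv.Perm.mul_apply, ih, h2']
    congr 2; ring

theorem antipode_zpow_even_inr (l : ℤ) (c : Bool) (z : Bool) :
    (antipode n ^ (2 * l)) (c, .inr z) = (c, .inr z) := by
  have h2 : (antipode n ^ (2 : ℤ)) (c, .inr z) = (c, .inr z) := by
    cases c <;> rfl
  have h2' : (antipode n ^ (2 : ℤ))⁻¹ (c, .inr z) = (c, .inr z) := by
    rw [Equiv.Perm.inv_eq_iff_eq, h2]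
  rw [zpow_mul]
  induction l with
  | zero => simp
  | succ k ih =>
    rw [add_comm, zpow_one_add, Equiv.Perm.mul_apply, ih, h2]
  | pred k ih =>
    rw [show (-(k : ℤ) - 1) = -1 + -k by ring, zpow_add, zpow_neg_one, Equiv.Perm.mul_apply, ih, h2']

theorem antipode_zpow_odd (l : ℤ) (x : Vert) :
    (antipode n ^ (2 * l + 1)) x = antipode n ((antipode n ^ (2 * l)) x) := by
  rw [add_comm, zpow_one_add, Equiv.Perm.mul_apply]

theorem exists_of_sameCycle_inl {c : Bool} {i : ℤ} {y : Vert}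
    (h : (antipode n).SameCycle (c, .inl i) y) (hy : y.1 = c) :
    ∃ l : ℤ, y = (c, .inl (i - l * n)) := by
  obtain ⟨k, rfl⟩ := h
  obtain ⟨l, rfl | rfl⟩ := Int.even_or_odd' k
  · exact ⟨l, antipode_zpow_even_inl n l c i⟩
  · rw [antipode_zpow_odd, antipode_zpow_even_inl, antipode_fst] at hy
    simp at hy

theorem eq_of_sameCycle_inr {c z : Bool} {y : Vert}
    (h : (antipode n).SameCycle (c, .inr z) y) : y = (y.1, .inr z) := by
  obtain ⟨k, rfl⟩ := h
  obtain ⟨l, rfl | rfl⟩ := Int.even_or_odd' k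
  · simp [antipode_zpow_even_inr n l c z]
  · simp [antipode_zpow_odd, antipode_zpow_even_inr]

theorem sameCycle_inl_sub (c : Bool) (i l : ℤ) :
    (antipode n).SameCycle (c, .inl i) (c, .inl (i - l * n)) :=
  ⟨2 * l, antipode_zpow_even_inl n l c i⟩

theorem sameCycle_inr (c d z : Bool) :
    (antipode n).SameCycle (c, .inr z) (d, .inr z) := by
  by_cases h : c = d
  · rw [h]
  · refine ⟨1, ?_⟩
    cases c <;> cases d <;> simp_all

/-- The simplices of the unrolled complex. -/
structure IsSimplex (σ : Finset Vert) : Prop where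
  nonempty : σ.Nonempty
  consecutive : ∀ c i j, (c, .inl i) ∈ σ → (c, .inl j) ∈ σ → j ≤ i + 1
  bounds : ∀ i j, (true, .inl i) ∈ σ → (false, .inl j) ∈ σ → i + 1 ≤ j ∧ j ≤ i + n - 1
  not_both : ∀ z, (true, .inr z) ∈ σ → (false, .inr z) ∉ σ
  -- Together with `bounds` this leaves `j - i ∈ {1, 2}`, the lower staircase of the strip. The
  -- condition on the other apex is its image under the antipode and leaves `j - i ∈ {n - 2, n -
  -- 1}`.
  apex_true : (true, .inr false) ∈ σ → ∀ i j, (true, .inl i) ∈ σ → (false, .inl j) ∈ σ → j ≤ i + 2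
  apex_false : (false, .inr false) ∈ σ →
    ∀ i j, (true, .inl i) ∈ σ → (false, .inl j) ∈ σ → i + n - 2 ≤ j
  pole : ∀ c i, (c, .inr true) ∈ σ → (c, .inl i) ∉ σ

variable {n}

theorem IsSimplex.mono {σ τ : Finset Vert} (h : IsSimplex n σ) (hτ : τ ⊆ σ) (hne : τ.Nonempty) :
    IsSimplex n τ where
  nonempty := hne
  consecutive c i j hi hj := h.consecutive c i j (hτ hi) (hτ hj)
  bounds i j hi hj := h.bounds i j (hτ hi) (hτ hj)
  not_both z h1 h2 := h.not_both z (hτ h1) (hτ h2)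
  apex_true ha i j hi hj := h.apex_true (hτ ha) i j (hτ hi) (hτ hj)
  apex_false ha i j hi hj := h.apex_false (hτ ha) i j (hτ hi) (hτ hj)
  pole c i h1 h2 := h.pole c i (hτ h1) (hτ h2)

theorem mem_antipode_smul {σ : Finset Vert} {x : Vert} :
    x ∈ antipode n • σ ↔ (antipode n).symm x ∈ σ := by
  rw [Finset.mem_smul_finset]
  constructor
  · rintro ⟨y, hy, rfl⟩
    simpa using hy
  · intro h
    exact ⟨_, h, by simp⟩

theorem isSimplex_smul_iff {σ : Finset Vert} : IsSimplex n (antipode n • σ) ↔ IsSimplex n σ := by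
  constructor
  · intro h
    have h1 := h.consecutive
    have h2 := h.bounds
    have h3 := h.not_both
    have h4 := h.apex_true
    have h5 := h.apex_false
    have h6 := h.pole
    simp only [mem_antipode_smul, antipode_symm_true, antipode_symm_false, antipode_symm_inr,
      Bool.not_true, Bool.not_false] at h1 h2 h3 h4 h5 h6
    have hn := h.nonempty
    refine ⟨by simpa using hn, ?_, ?_, ?_, ?_, ?_, ?_⟩
    · rintro (_ | _) i j hi hj
      · have := h1 true (i - n) (j - n) (by simpa using hi) (by simpa using hj)
        omega
      · exact h1 false i j (by simpa using hi) (by simpa using hj)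
    · intro i j hi hj
      have := h2 (j - n) i (by simpa using hj) hi
      omega
    · exact fun z ht hf => h3 z hf ht
    · intro ha i j hi hj
      have := h5 ha (j - n) i (by simpa using hj) hi
      omega
    · intro ha i j hi hj
      have := h4 ha (j - n) i (by simpa using hj) hi
      omega
    · rintro (_ | _) i hp hi
      · exact h6 true (i - n) (by simpa using hp) (by simpa using hi)
      · exact h6 false i (by simpa using hp) (by simpa using hi)
  · intro h
    refine ⟨h.nonempty.smul_finset, ?_, ?_, ?_, ?_, ?_, ?_⟩ <;>
      simp only [mem_antipode_smul, antipode_symm_true, antipode_symm_false, antipode_symm_inr,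
        Bool.not_true, Bool.not_false]
    · rintro (_ | _) i j hi hj
      · exact h.consecutive true i j hi hj
      · have := h.consecutive false _ _ hi hj
        omega
    · intro i j hi hj
      have := h.bounds _ _ hj hi
      omega
    · exact fun z ht hf => h.not_both z hf ht
    · intro ha i j hi hj
      have := h.apex_false ha _ _ hj hi
      omega
    · intro ha i j hi hj
      have := h.apex_true ha _ _ hj hi
      omega
    · rintro (_ | _) i hp hi
      · exact h.pole true _ hp hi
      · exact h.pole false _ hp hi

/-- Even powers shift a cycle by a multiple of `n`, too far for consecutive indices unless the shift
is zero, and fix apices and poles. Odd powers change the colour, and the strip contains no pair with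
`j ≡ i` modulo `n`. -/
theorem IsSimplex.rigid (hn : 3 ≤ n) {σ : Finset Vert} (h : IsSimplex n σ) {x : Vert} (hx : x ∈ σ)
    (k : ℤ) (hk : (antipode n ^ k) x ∈ σ) : (antipode n ^ k) x = x := by
  obtain ⟨l, rfl | rfl⟩ := Int.even_or_odd' k
  · obtain ⟨c, i | z⟩ := x
    · rw [antipode_zpow_even_inl] at hk ⊢
      have h1 := h.consecutive _ _ _ hx hk
      have h2 := h.consecutive _ _ _ hk hx
      have : l = 0 := by
        have h3 : l < 1 := by nlinarith
        have h4 : -1 < l := by nlinarith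
        omega
      simp [this]
    · exact antipode_zpow_even_inr n l c z
  · exfalso
    rw [antipode_zpow_odd] at hk
    obtain ⟨c, i | z⟩ := x
    · rw [antipode_zpow_even_inl] at hk
      cases c
      · have := h.bounds _ _ hk hx
        have h3 : -1 < l := by nlinarith
        have h4 : l < 0 := by nlinarith
        omega
      · have := h.bounds _ _ hx hk
        have h3 : -1 < l := by nlinarith
        have h4 : l < 0 := by nlinarith
        omega
    · rw [antipode_zpow_even_inr, antipode_inr] at hk
      cases c
      · exact h.not_both z hk hx
      · exact h.not_both z hx hk

/-- Some index, of colour true if there is one, can be shifted into `[0, n)`. The strip and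
consecutiveness then confine all the others to `[-n, 2n]`. -/
theorem exists_finite_representatives (hn : 3 ≤ n) :
    ∃ T : Set (Finset Vert), T.Finite ∧ ∀ σ, IsSimplex n σ → ∃ k : ℤ, antipode n ^ k • σ ∈ T := by
  let W : Finset Vert := Finset.univ ×ˢ ((Finset.Icc (-n) (2 * n)).disjSum Finset.univ)
  refine ⟨W.powerset, Finset.finite_toSet _, fun σ h => ?_⟩
  suffices hs : ∃ l : ℤ, ∀ c i, (c, .inl i) ∈ σ → -n ≤ i - l * n ∧ i - l * n ≤ 2 * n by
    obtain ⟨l, hl⟩ := hs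
    refine ⟨2 * l, ?_⟩
    rw [Finset.mem_coe, Finset.mem_powerset]
    intro x hx
    obtain ⟨⟨c, i | z⟩, hy, rfl⟩ := Finset.mem_smul_finset.1 hx
    · rw [Equiv.Perm.smul_def, antipode_zpow_even_inl]
      simpa [W] using hl c i hy
    · rw [Equiv.Perm.smul_def, antipode_zpow_even_inr]
      simp [W]
  by_cases hb : ∃ i, (true, .inl i) ∈ σ
  · obtain ⟨i, hi⟩ := hb
    have h0 := Int.emod_nonneg i (by omega : n ≠ 0)
    have h1 := Int.emod_lt_of_pos i (by omega : 0 < n)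
    have h2 := Int.emod_add_mul_ediv i n
    refine ⟨i / n, ?_⟩
    rw [mul_comm]
    rintro (_ | _) j hj
    · have := h.bounds i j hi hj
      omega
    · have h3 := h.consecutive _ _ _ hi hj
      have h4 := h.consecutive _ _ _ hj hi
      omega
  · by_cases hw : ∃ i, (false, .inl i) ∈ σ
    · obtain ⟨i, hi⟩ := hw
      have h0 := Int.emod_nonneg i (by omega : n ≠ 0)
      have h1 := Int.emod_lt_of_pos i (by omega : 0 < n)
      have h2 := Int.emod_add_mul_ediv i n
      refine ⟨i / n, ?_⟩
      rw [mul_comm]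
      rintro (_ | _) j hj
      · have h3 := h.consecutive _ _ _ hi hj
        have h4 := h.consecutive _ _ _ hj hi
        omega
      · exact (hb ⟨j, hj⟩).elim
    · refine ⟨0, ?_⟩
      rintro (_ | _) j hj
      · exact (hw ⟨j, hj⟩).elim
      · exact (hb ⟨j, hj⟩).elim

theorem IsSimplex.exists_max {σ : Finset Vert} (h : IsSimplex n σ) {c : Bool} {i : ℤ}
    (hi : (c, .inl i) ∈ σ) :
    ∃ I, (c, .inl I) ∈ σ ∧ ∀ k, (c, .inl k) ∈ σ → I - 1 ≤ k ∧ k ≤ I := by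
  by_cases h1 : (c, .inl (i + 1)) ∈ σ
  · refine ⟨i + 1, h1, fun k hk => ?_⟩
    have := h.consecutive _ _ _ hi hk
    have := h.consecutive _ _ _ hk h1
    omega
  · refine ⟨i, hi, fun k hk => ?_⟩
    have := h.consecutive _ _ _ hi hk
    have := h.consecutive _ _ _ hk hi
    have : k ≠ i + 1 := by rintro rfl; exact h1 hk
    omega

theorem IsSimplex.exists_insert (hn : 3 ≤ n) {σ : Finset Vert} (h : IsSimplex n σ)
    (hσ : ∀ x ∈ σ, ∀ y ∈ σ, x.1 = y.1) : ∃ w ∉ σ, IsSimplex n (insert w σ) := by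
  obtain ⟨x₀, hx₀⟩ := h.nonempty
  obtain ⟨c, hc⟩ : ∃ c, ∀ x ∈ σ, x.1 = c := ⟨x₀.1, fun x hx => hσ x hx x₀ hx₀⟩
  have hno : ∀ a, ((!c), a) ∉ σ := fun a ha => by simpa using hc _ ha
  by_cases hcyc : ∃ i, (c, .inl i) ∈ σ
  · obtain ⟨i, hi⟩ := hcyc
    obtain ⟨I, hI, hmax⟩ := h.exists_max hi
    have hp : (c, .inr true) ∉ σ := fun hp => h.pole c i hp hi
    -- The new vertex lies on the staircase belonging to the apex of colour `c`: it is a legal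
    -- neighbour of both `I - 1` and `I`, even if that apex is in `σ`. The upper or lower bound of
    -- the strip for `I - 1` is where `3 ≤ n` enters.
    cases c
    · refine ⟨(true, .inl (I - n + 1)), hno _, ⟨by simp, ?_, ?_, ?_, ?_, ?_, ?_⟩⟩ <;>
        simp_all <;> grind
    · refine ⟨(false, .inl (I + 1)), hno _, ⟨by simp, ?_, ?_, ?_, ?_, ?_, ?_⟩⟩ <;>
        simp_all <;> grind
  · refine ⟨((!c), .inl 0), hno _, ⟨by simp, ?_, ?_, ?_, ?_, ?_, ?_⟩⟩ <;>
      cases c <;> simp_all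

theorem isSimplex_singleton (x : Vert) : IsSimplex n {x} := by
  refine ⟨by simp, ?_, ?_, ?_, ?_, ?_, ?_⟩ <;> obtain ⟨_ | _, _ | _⟩ := x <;> simp_all

theorem isSimplex_pair_inl {i j : ℤ} (h1 : i + 1 ≤ j) (h2 : j ≤ i + n - 1) :
    IsSimplex n {(true, .inl i), (false, .inl j)} := by
  refine ⟨by simp, ?_, ?_, ?_, ?_, ?_, ?_⟩ <;> simp_all

theorem isSimplex_pair_inr (c z : Bool) (i : ℤ) :
    IsSimplex n {(c, .inl i), ((!c), .inr z)} := by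
  refine ⟨by simp, ?_, ?_, ?_, ?_, ?_, ?_⟩ <;> cases c <;> simp_all

theorem isSimplex_pair_inr_inr {c z w : Bool} (h : z ≠ w) :
    IsSimplex n {(c, .inr z), ((!c), .inr w)} := by
  refine ⟨by simp, ?_, ?_, ?_, ?_, ?_, ?_⟩ <;> cases c <;> cases z <;> cases w <;> simp_all

theorem exists_sameCycle_color (c : Bool) (x : Vert) :
    ∃ y : Vert, (antipode n).SameCycle x y ∧ y.1 = c := by
  by_cases h : x.1 = c
  · exact ⟨x, .refl _ _, h⟩
  · exact ⟨antipode n x, ⟨1, rfl⟩, by rw [antipode_fst]; cases c <;> simp_all⟩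

theorem exists_sameCycle_mem_Ico (hn : 0 < n) (c : Bool) (i a : ℤ) :
    ∃ j, a ≤ j ∧ j < a + n ∧ (antipode n).SameCycle (c, .inl i) (c, .inl j) := by
  have h0 := Int.emod_nonneg (i - a) (by omega : n ≠ 0)
  have h1 := Int.emod_lt_of_pos (i - a) (by omega : 0 < n)
  have h2 := Int.emod_add_mul_ediv (i - a) n
  refine ⟨i - (i - a) / n * n, ?_, ?_, sameCycle_inl_sub n c i _⟩ <;> rw [mul_comm] <;> omega

/-- Among `n` consecutive indices of the other colour, all but the first are neighbours of a given
cycle vertex, and the first lies in its own orbit. -/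
theorem exists_edge_of_not_sameCycle (hn : 3 ≤ n) (x y : Vert) (h : ¬ (antipode n).SameCycle x y) :
    ∃ y', (antipode n).SameCycle y y' ∧ x.1 ≠ y'.1 ∧ IsSimplex n {x, y'} := by
  obtain ⟨y₁, hy₁, hc⟩ := exists_sameCycle_color (n := n) (!x.1) y
  have h₁ : ¬ (antipode n).SameCycle x y₁ := fun h' => h (h'.trans hy₁.symm)
  suffices hs : ∃ y', (antipode n).SameCycle y₁ y' ∧ x.1 ≠ y'.1 ∧ IsSimplex n {x, y'} by
    obtain ⟨y', h1, h2⟩ := hs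
    exact ⟨y', hy₁.trans h1, h2⟩
  obtain ⟨c, x⟩ := x
  obtain ⟨d, y₁⟩ := y₁
  obtain rfl : d = !c := hc
  rcases x with i | z
  · rcases y₁ with j | w
    · cases c
      · obtain ⟨k, hk1, hk2, hk⟩ := exists_sameCycle_mem_Ico (by omega : 0 < n) true j (i - n)
        refine ⟨_, hk, by simp, ?_⟩
        rw [Finset.pair_comm]
        refine isSimplex_pair_inl (by omega) ?_
        by_contra hlt
        obtain rfl : k = i - n := by omega
        exact h₁ (Equiv.Perm.SameCycle.trans ⟨1, rfl⟩ hk.symm)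
      · obtain ⟨k, hk1, hk2, hk⟩ := exists_sameCycle_mem_Ico (by omega : 0 < n) false j i
        refine ⟨_, hk, by simp, isSimplex_pair_inl ?_ (by omega)⟩
        by_contra hlt
        obtain rfl : k = i := by omega
        exact h₁ (Equiv.Perm.SameCycle.trans ⟨1, rfl⟩ hk.symm)
    · exact ⟨_, .refl _ _, by simp, isSimplex_pair_inr c w i⟩
  · refine ⟨_, .refl _ _, by simp, ?_⟩
    rcases y₁ with j | w
    · rw [Finset.pair_comm]
      simpa using isSimplex_pair_inr (n := n) (!c) z j
    · refine isSimplex_pair_inr_inr ?_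
      rintro rfl
      exact h₁ (sameCycle_inr n _ _ _)

/-- For two cycle vertices the difference of the indices is confined to an interval shorter than
`n`, so both ends are shifted by the same multiple of `n`. Apices and poles are fixed by every even
power and impose no condition. -/
theorem exists_zpow_of_edges (hn : 3 ≤ n) {x y x' y' : Vert} (h : IsSimplex n {x, y})
    (h' : IsSimplex n {x', y'}) (hc : x.1 ≠ y.1) (hc' : x'.1 ≠ y'.1) (hxx : x.1 = x'.1)
    (hx : (antipode n).SameCycle x x') (hy : (antipode n).SameCycle y y') :
    ∃ k : ℤ, (antipode n ^ k) x = x' ∧ (antipode n ^ k) y = y' := by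
  have hyy : y'.1 = y.1 := by
    cases h1 : x.1 <;> cases h2 : y.1 <;> cases h3 : x'.1 <;> cases h4 : y'.1 <;> simp_all
  obtain ⟨c, x | z⟩ := x
  · obtain ⟨l, rfl⟩ := exists_of_sameCycle_inl n hx hxx.symm
    obtain ⟨d, y | w⟩ := y
    · obtain ⟨m, rfl⟩ := exists_of_sameCycle_inl n hy hyy
      refine ⟨2 * l, antipode_zpow_even_inl n l c x, ?_⟩
      rw [antipode_zpow_even_inl]
      have : l = m := by
        cases c <;> cases d <;> simp at hc
        · have h1 := h.bounds y x (by simp) (by simp)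
          have h2 := h'.bounds (y - m * n) (x - l * n) (by simp) (by simp)
          have h3 : l - m < 1 := by nlinarith
          have h4 : -1 < l - m := by nlinarith
          omega
        · have h1 := h.bounds x y (by simp) (by simp)
          have h2 := h'.bounds (x - l * n) (y - m * n) (by simp) (by simp)
          have h3 : l - m < 1 := by nlinarith
          have h4 : -1 < l - m := by nlinarith
          omega
      rw [this]
    · refine ⟨2 * l, antipode_zpow_even_inl n l c x, ?_⟩
      rw [antipode_zpow_even_inr, eq_of_sameCycle_inr n hy, hyy]
  · rw [eq_of_sameCycle_inr n hx, ← hxx]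
    obtain ⟨d, y | w⟩ := y
    · obtain ⟨m, rfl⟩ := exists_of_sameCycle_inl n hy hyy
      exact ⟨2 * m, antipode_zpow_even_inr n m c z, antipode_zpow_even_inl n m d y⟩
    · exact ⟨0, rfl, by rw [eq_of_sameCycle_inr n hy, hyy]; rfl⟩

/-- A vertex for each orbit of the antipode. -/
def representative (m : ℕ) : Fin m ⊕ Bool → Vert
  | .inl i => (true, .inl (i : ℤ))
  | .inr z => (true, .inr z)

theorem existsUnique_representative (m : ℕ) (hm : 0 < m) (v : Vert) :
    ∃! w, (antipode m).SameCycle (representative m w) v := by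
  obtain ⟨⟨c, a⟩, hy, rfl⟩ := exists_sameCycle_color (n := m) true v
  suffices h : ∃ w, (antipode m).SameCycle (representative m w) (true, a) ∧
      ∀ w', (antipode m).SameCycle (representative m w') (true, a) → w' = w by
    obtain ⟨w, h1, h2⟩ := h
    exact ⟨w, h1.trans hy.symm, fun w' h' => h2 w' (h'.trans hy)⟩
  rcases a with i | z
  · obtain ⟨j, h0, h1, hj⟩ := exists_sameCycle_mem_Ico (by omega : (0 : ℤ) < m) true i 0
    lift j to ℕ using h0
    refine ⟨.inl ⟨j, by omega⟩, hj.symm, ?_⟩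
    rintro (w | w) hw
    · obtain ⟨l, hl⟩ := exists_of_sameCycle_inl _ (hw.trans hj) rfl
      have hl' : (j : ℤ) = w - l * m := by simpa [representative] using hl
      have := w.2
      have h3 : l < 1 := by nlinarith
      have h4 : -1 < l := by nlinarith
      obtain rfl : l = 0 := by omega
      congr 1
      ext
      simp only
      omega
    · have := eq_of_sameCycle_inr _ hw
      simp at this
  · refine ⟨.inr z, .refl _ _, ?_⟩
    rintro (w | w) hw
    · have := eq_of_sameCycle_inr _ hw.symm
      simp [representative] at this
    · have := eq_of_sameCycle_inr _ hw
      simp at this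
      rw [this]

end DoubleCycle

/-! ### The map to `ℝ⁴`: symmetry, homogeneity, continuity -/

namespace DoubleCycle

/-- The indicator function of the cycle of colour `c`. -/
def cycleIndicator (c : Bool) : Vert → ℝ
  | (d, .inl _) => if d = c then 1 else 0
  | (_, .inr _) => 0

/-- The angular position on the cycle of colour `c`, the full turn being `n`. -/
noncomputable def cyclePosition (n : ℤ) (c : Bool) : Vert → ℝ
  -- Shifting the second cycle by half a turn makes the antipode act on the positions of both cycles
  -- as `θ ↦ θ - n / 2`.
  | (d, .inl i) => if d = c then (i : ℝ) - (if c then 0 else (n : ℝ) / 2) else 0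
  | (_, .inr _) => 0

/-- The total weight of the cycle of colour `c`. -/
noncomputable def mass (c : Bool) : (Vert →₀ ℝ) →ₗ[ℝ] ℝ :=
  Finsupp.linearCombination ℝ (cycleIndicator c)

/-- The first moment of the weights on the cycle of colour `c`. -/
noncomputable def moment (n : ℤ) (c : Bool) : (Vert →₀ ℝ) →ₗ[ℝ] ℝ :=
  Finsupp.linearCombination ℝ (cyclePosition n c)

variable (n : ℤ)

theorem mass_antipode (c : Bool) (t : Vert →₀ ℝ) :
    mass c (t.equivMapDomain (antipode n)) = mass (!c) t := by
  rw [mass, mass, Finsupp.linearCombination_equivMapDomain]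
  congr 2
  ext x
  obtain ⟨_ | _, _ | _⟩ := x <;> cases c <;> simp [cycleIndicator]

theorem moment_antipode (c : Bool) (t : Vert →₀ ℝ) :
    moment n c (t.equivMapDomain (antipode n)) = moment n (!c) t - n / 2 * mass (!c) t := by
  rw [moment, mass, moment, Finsupp.linearCombination_equivMapDomain,
    Finsupp.linearCombination_apply, Finsupp.linearCombination_apply,
    Finsupp.linearCombination_apply, Finsupp.mul_sum, ← Finsupp.sum_sub]
  refine Finsupp.sum_congr fun x _ => ?_
  obtain ⟨_ | _, _ | _⟩ := x <;> cases c <;> simp [cycleIndicator, cyclePosition] <;> ring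

/-- The point with given distance from the axis, angle, and two further coordinates. -/
noncomputable def polarPoint (r θ u v : ℝ) : EuclideanSpace ℝ (Fin 4) :=
  !₂[r * Real.cos (2 * Real.pi / n * θ), r * Real.sin (2 * Real.pi / n * θ), u, v]

/-- The map from the unrolled complex to `ℝ⁴`. -/
noncomputable def toSpace (t : Vert →₀ ℝ) : EuclideanSpace ℝ (Fin 4) :=
  polarPoint n (mass true t + mass false t)
    ((moment n true t + moment n false t) / (mass true t + mass false t))
    (mass false t - mass true t + (t (true, .inr true) - t (false, .inr true)))
    -- For masses `p`, `q` and mean positions `x`, `y` this fraction is `pq(x - y) / (p + q)`: it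
    -- measures the position across the strip, and the apices continue it beyond the two staircases.
    -- With no mass on the cycles it is `0 / 0 = 0`.
    ((mass false t * moment n true t - mass true t * moment n false t) /
        (mass true t + mass false t) + (t (true, .inr false) - t (false, .inr false)))

variable {n}

theorem neg_polarPoint (hn : n ≠ 0) (r θ u v : ℝ) :
    -polarPoint n r θ u v = polarPoint n r (θ - n / 2) (-u) (-v) := by
  have hn' : (n : ℝ) ≠ 0 := by exact_mod_cast hn
  have h : 2 * Real.pi / n * (θ - n / 2) = 2 * Real.pi / n * θ - Real.pi := by field_simp
  ext i
  fin_cases i <;> simp [polarPoint, h, Real.cos_sub_pi, Real.sin_sub_pi]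

theorem toSpace_antipode (hn : n ≠ 0) (t : Vert →₀ ℝ) :
    toSpace n (t.equivMapDomain (antipode n)) = -toSpace n t := by
  rw [toSpace, toSpace, neg_polarPoint hn]
  simp only [mass_antipode, moment_antipode, Finsupp.equivMapDomain_apply, antipode_symm_inr,
    Bool.not_true, Bool.not_false]
  rw [add_comm (mass false t)]
  by_cases h : mass true t + mass false t = 0
  · simp only [h, polarPoint, zero_mul, div_zero]
    congr 1
    ext i
    fin_cases i <;> simp
    ring
  · congr 1
    · field_simp; ring
    · ring
    · field_simp; ring

theorem toSpace_smul {c : ℝ} (hc : 0 < c) (t : Vert →₀ ℝ) :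
    toSpace n (c • t) = c • toSpace n t := by
  ext i
  have hc' := hc.ne'
  have h1 : (c * moment n true t + c * moment n false t) / (c * mass true t + c * mass false t)
      = (moment n true t + moment n false t) / (mass true t + mass false t) := by
    rw [← mul_add, ← mul_add, mul_div_mul_left _ _ hc']
  have h2 : (c * mass false t * (c * moment n true t) - c * mass true t * (c * moment n false t)) /
      (c * mass true t + c * mass false t) =
      c * ((mass false t * moment n true t - mass true t * moment n false t) /
        (mass true t + mass false t)) := by
    rw [show c * mass false t * (c * moment n true t) - c * mass true t * (c * moment n false t) =
      c * (c * (mass false t * moment n true t - mass true t * moment n false t)) by ring,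
      ← mul_add, mul_div_mul_left _ _ hc', mul_div_assoc]
  fin_cases i <;> simp [toSpace, polarPoint, h1, h2] <;> ring

/-- This handles the quotients in `toSpace` where the mass of the cycles vanishes. -/
theorem continuous_of_abs_le {X : Type*} [TopologicalSpace X] {s F : X → ℝ} (hs : Continuous s)
    {C : ℝ} (hF : ∀ x, |F x| ≤ C * s x) (hc : ∀ x, s x ≠ 0 → ContinuousAt F x) :
    Continuous F := by
  rw [continuous_iff_continuousAt]
  intro x
  by_cases hx : s x = 0
  · have h0 : F x = 0 := by simpa [hx] using hF x
    rw [ContinuousAt, h0]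
    refine squeeze_zero_norm (a := fun y => C * s y) hF ?_
    have h : Filter.Tendsto (fun y => C * s y) (nhds x) (nhds (C * s x)) :=
      (hs.continuousAt (x := x)).tendsto.const_mul C
    rwa [hx, mul_zero] at h
  · exact hc x hx

theorem cycleIndicator_nonneg (c : Bool) (x : Vert) : 0 ≤ cycleIndicator c x := by
  obtain ⟨d, i | z⟩ := x <;> simp only [cycleIndicator]
  · split_ifs <;> norm_num
  · rfl

theorem mass_nonneg {c : Bool} {t : Vert →₀ ℝ} (ht : ∀ x, 0 ≤ t x) : 0 ≤ mass c t := by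
  rw [mass, Finsupp.linearCombination_apply]
  exact Finset.sum_nonneg fun x _ => mul_nonneg (ht x) (cycleIndicator_nonneg c x)

theorem continuous_toSpace {m : ℕ} (e : Fin (m + 1) ↪ Vert) :
    Continuous fun t : stdSimplex ℝ (Fin (m + 1)) =>
      toSpace n (∑ i, Finsupp.single (e i) (t.1 i)) := by
  have hcont : ∀ i, Continuous fun t : stdSimplex ℝ (Fin (m + 1)) => t.1 i := fun i =>
    (continuous_apply i).comp continuous_subtype_val
  have hmass : ∀ c, Continuous fun t : stdSimplex ℝ (Fin (m + 1)) =>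
      mass c (∑ i, Finsupp.single (e i) (t.1 i)) := by
    intro c
    simp only [mass, map_sum, Finsupp.linearCombination_single, smul_eq_mul]
    exact continuous_finsetSum _ fun i _ => (hcont i).mul continuous_const
  have hmoment : ∀ c, Continuous fun t : stdSimplex ℝ (Fin (m + 1)) =>
      moment n c (∑ i, Finsupp.single (e i) (t.1 i)) := by
    intro c
    simp only [moment, map_sum, Finsupp.linearCombination_single, smul_eq_mul]
    exact continuous_finsetSum _ fun i _ => (hcont i).mul continuous_const
  have heval : ∀ x, Continuous fun t : stdSimplex ℝ (Fin (m + 1)) =>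
      (∑ i, Finsupp.single (e i) (t.1 i)) x := by
    intro x
    simp only [Finsupp.finsetSum_apply, Finsupp.single_apply]
    refine continuous_finsetSum _ fun i _ => ?_
    split_ifs
    · exact hcont i
    · exact continuous_const
  have hnonneg : ∀ c, ∀ t : stdSimplex ℝ (Fin (m + 1)),
      0 ≤ mass c (∑ i, Finsupp.single (e i) (t.1 i)) := by
    intro c t
    refine mass_nonneg fun x => ?_
    rw [Finsupp.finsetSum_apply]
    refine Finset.sum_nonneg fun i _ => ?_
    rw [Finsupp.single_apply]
    split_ifs
    · exact t.2.1 i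
    · rfl
  -- Only finitely many positions occur on a single simplex, so the moments are bounded by a
  -- multiple of the masses.
  obtain ⟨C, hC, hbound⟩ : ∃ C : ℝ, 0 ≤ C ∧ ∀ c, ∀ t : stdSimplex ℝ (Fin (m + 1)),
      |moment n c (∑ i, Finsupp.single (e i) (t.1 i))| ≤
        C * mass c (∑ i, Finsupp.single (e i) (t.1 i)) := by
    refine ⟨∑ c, ∑ i, |cyclePosition n c (e i)|,
      Finset.sum_nonneg fun _ _ => Finset.sum_nonneg fun _ _ => abs_nonneg _, fun c t => ?_⟩
    simp only [moment, mass, map_sum, Finsupp.linearCombination_single, smul_eq_mul]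
    rw [Finset.mul_sum]
    refine (Finset.abs_sum_le_sum_abs _ _).trans (Finset.sum_le_sum fun i _ => ?_)
    rw [abs_mul, abs_of_nonneg (t.2.1 i), mul_left_comm]
    refine mul_le_mul_of_nonneg_left ?_ (t.2.1 i)
    have h1 : |cyclePosition n c (e i)| ≤ ∑ c, ∑ i, |cyclePosition n c (e i)| :=
      (Finset.single_le_sum (f := fun i => |cyclePosition n c (e i)|)
        (fun _ _ => abs_nonneg _) (Finset.mem_univ i)).trans
      (Finset.single_le_sum (f := fun c => ∑ i, |cyclePosition n c (e i)|)
        (fun _ _ => Finset.sum_nonneg fun _ _ => abs_nonneg _) (Finset.mem_univ c))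
    generalize (∑ c, ∑ i, |cyclePosition n c (e i)|) = B at h1
    generalize e i = x at h1 ⊢
    obtain ⟨d, j | z⟩ := x
    · by_cases hd : d = c
      · simpa [cycleIndicator, hd] using h1
      · simp [cycleIndicator, cyclePosition, hd]
    · simp [cycleIndicator, cyclePosition]
  have hs : Continuous fun t : stdSimplex ℝ (Fin (m + 1)) =>
      mass true (∑ i, Finsupp.single (e i) (t.1 i)) +
        mass false (∑ i, Finsupp.single (e i) (t.1 i)) := (hmass true).add (hmass false)
  have hangle : ∀ t : stdSimplex ℝ (Fin (m + 1)),
      mass true (∑ i, Finsupp.single (e i) (t.1 i)) +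
        mass false (∑ i, Finsupp.single (e i) (t.1 i)) ≠ 0 →
      ContinuousAt (fun t : stdSimplex ℝ (Fin (m + 1)) =>
        2 * Real.pi / n * ((moment n true (∑ i, Finsupp.single (e i) (t.1 i)) +
          moment n false (∑ i, Finsupp.single (e i) (t.1 i))) /
        (mass true (∑ i, Finsupp.single (e i) (t.1 i)) +
        mass false (∑ i, Finsupp.single (e i) (t.1 i))))) t := fun t ht =>
    continuousAt_const.mul
      (((hmoment true).add (hmoment false)).continuousAt.div hs.continuousAt ht)
  refine (PiLp.continuous_toLp 2 _).comp (continuous_pi fun j => ?_)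
  fin_cases j
  · refine continuous_of_abs_le hs (C := 1) (fun t => ?_) fun t ht => ?_
    · have h0 := add_nonneg (hnonneg true t) (hnonneg false t)
      simp only [Fin.zero_eta, Matrix.cons_val_zero]
      rw [abs_mul, abs_of_nonneg h0, one_mul]
      exact mul_le_of_le_one_right h0 (Real.abs_cos_le_one _)
    · exact hs.continuousAt.mul (Real.continuous_cos.continuousAt.comp (hangle t ht))
  · refine continuous_of_abs_le hs (C := 1) (fun t => ?_) fun t ht => ?_
    · have h0 := add_nonneg (hnonneg true t) (hnonneg false t)
      simp only [Fin.mk_one, Matrix.cons_val_one, Matrix.cons_val_zero]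
      rw [abs_mul, abs_of_nonneg h0, one_mul]
      exact mul_le_of_le_one_right h0 (Real.abs_sin_le_one _)
    · exact hs.continuousAt.mul (Real.continuous_sin.continuousAt.comp (hangle t ht))
  · exact ((hmass false).sub (hmass true)).add ((heval _).sub (heval _))
  · refine Continuous.add ?_ ((heval _).sub (heval _))
    refine continuous_of_abs_le hs (C := 2 * C) (fun t => ?_) fun t ht => ?_
    · have h1 := hnonneg true t
      have h2 := hnonneg false t
      have h3 := hbound true t
      have h4 := hbound false t
      generalize mass true (∑ i, Finsupp.single (e i) (t.1 i)) = p at *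
      generalize mass false (∑ i, Finsupp.single (e i) (t.1 i)) = q at *
      generalize moment n true (∑ i, Finsupp.single (e i) (t.1 i)) = a at *
      generalize moment n false (∑ i, Finsupp.single (e i) (t.1 i)) = b at *
      rw [abs_div, abs_of_nonneg (add_nonneg h1 h2)]
      refine div_le_of_le_mul₀ (by positivity) (by positivity) ?_
      refine (abs_sub _ _).trans ?_
      rw [abs_mul, abs_mul, abs_of_nonneg h1, abs_of_nonneg h2]
      nlinarith [mul_le_mul_of_nonneg_left h3 h2, mul_le_mul_of_nonneg_left h4 h1,
        mul_nonneg hC (mul_nonneg h1 h1), mul_nonneg hC (mul_nonneg h2 h2),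
        mul_nonneg hC (mul_nonneg h1 h2)]
    · exact ((((hmass false).mul (hmoment true)).sub
        ((hmass true).mul (hmoment false))).continuousAt).div hs.continuousAt ht

/-! ### Injectivity up to the antipode -/

theorem isSimplex_zpow_smul_iff (k : ℤ) {σ : Finset Vert} :
    IsSimplex n (antipode n ^ k • σ) ↔ IsSimplex n σ :=
  zpow_smul_mem_iff (F := {σ | IsSimplex n σ}) (fun _ => isSimplex_smul_iff) k σ

theorem eq_zero_of_mass_eq_zero {c : Bool} {t : Vert →₀ ℝ} (ht : ∀ x, 0 ≤ t x)
    (h : mass c t = 0) (i : ℤ) : t (c, .inl i) = 0 := by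
  by_contra hi
  rw [mass, Finsupp.linearCombination_apply, Finsupp.sum, Finset.sum_eq_zero_iff_of_nonneg
    fun x _ => smul_nonneg (ht x) (cycleIndicator_nonneg c x)] at h
  have := h _ (Finsupp.mem_support_iff.2 hi)
  simp [cycleIndicator, hi] at this

theorem moment_le {c : Bool} {t : Vert →₀ ℝ} (ht : ∀ x, 0 ≤ t x) {I : ℤ}
    (h : ∀ k, t (c, .inl k) ≠ 0 → k ≤ I) :
    moment n c t ≤ (I - (if c then 0 else (n : ℝ) / 2)) * mass c t := by
  rw [mass, moment, Finsupp.linearCombination_apply, Finsupp.linearCombination_apply,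
    Finsupp.mul_sum]
  refine Finset.sum_le_sum fun x hx => ?_
  simp only [smul_eq_mul]
  rw [mul_left_comm]
  refine mul_le_mul_of_nonneg_left ?_ (ht x)
  obtain ⟨d, k | z⟩ := x
  · by_cases hd : d = c
    · subst hd
      have : (k : ℝ) ≤ I := by exact_mod_cast h k (Finsupp.mem_support_iff.1 hx)
      simpa [cyclePosition, cycleIndicator] using this
    · simp [cyclePosition, cycleIndicator, hd]
  · simp [cyclePosition, cycleIndicator]

theorem le_moment {c : Bool} {t : Vert →₀ ℝ} (ht : ∀ x, 0 ≤ t x) {I : ℤ}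
    (h : ∀ k, t (c, .inl k) ≠ 0 → I ≤ k) :
    (I - (if c then 0 else (n : ℝ) / 2)) * mass c t ≤ moment n c t := by
  rw [mass, moment, Finsupp.linearCombination_apply, Finsupp.linearCombination_apply,
    Finsupp.mul_sum]
  refine Finset.sum_le_sum fun x hx => ?_
  simp only [smul_eq_mul]
  rw [mul_left_comm]
  refine mul_le_mul_of_nonneg_left ?_ (ht x)
  obtain ⟨d, k | z⟩ := x
  · by_cases hd : d = c
    · subst hd
      have : (I : ℝ) ≤ k := by exact_mod_cast h k (Finsupp.mem_support_iff.1 hx)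
      simpa [cyclePosition, cycleIndicator] using this
    · simp [cyclePosition, cycleIndicator, hd]
  · simp [cyclePosition, cycleIndicator]

theorem exists_gt_of_lt_moment {c : Bool} {t : Vert →₀ ℝ} (ht : ∀ x, 0 ≤ t x) {I : ℤ}
    (h : (I - (if c then 0 else (n : ℝ) / 2)) * mass c t < moment n c t) :
    ∃ k, t (c, .inl k) ≠ 0 ∧ I < k := by
  by_contra! hc
  exact h.not_ge (moment_le ht hc)

theorem exists_lt_of_moment_lt {c : Bool} {t : Vert →₀ ℝ} (ht : ∀ x, 0 ≤ t x) {I : ℤ}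
    (h : moment n c t < (I - (if c then 0 else (n : ℝ) / 2)) * mass c t) :
    ∃ k, t (c, .inl k) ≠ 0 ∧ k < I := by
  by_contra! hc
  exact h.not_ge (le_moment ht hc)

theorem moment_eq_zero_of_mass_eq_zero {c : Bool} {t : Vert →₀ ℝ} (ht : ∀ x, 0 ≤ t x)
    (h : mass c t = 0) : moment n c t = 0 := by
  have h0 := eq_zero_of_mass_eq_zero ht h
  have h1 := moment_le (n := n) (I := 0) ht fun k hk => absurd (h0 k) hk
  have h2 := le_moment (n := n) (I := 0) ht fun k hk => absurd (h0 k) hk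
  rw [h, mul_zero] at h1 h2
  exact le_antisymm h1 h2

theorem exists_ne_zero_of_mass_pos {c : Bool} {t : Vert →₀ ℝ} (h : 0 < mass c t) :
    ∃ i, t (c, .inl i) ≠ 0 := by
  by_contra! hc
  refine h.ne' ?_
  rw [mass, Finsupp.linearCombination_apply]
  refine Finset.sum_eq_zero fun x hx => ?_
  obtain ⟨d, k | z⟩ := x
  · by_cases hd : d = c
    · subst hd
      exact absurd (hc k) (Finsupp.mem_support_iff.1 hx)
    · simp [cycleIndicator, hd]
  · simp [cycleIndicator]

theorem exists_eq_ite_of_mass_pos {c : Bool} {t : Vert →₀ ℝ} (ht : ∀ x, 0 ≤ t x)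
    (hσ : IsSimplex n t.support) (h : 0 < mass c t) :
    ∃ i α β, 0 < α ∧ 0 ≤ β ∧
      (∀ j, t (c, .inl j) = if j = i then α else if j = i + 1 then β else 0) ∧
      mass c t = α + β ∧
      moment n c t = (i - (if c then 0 else (n : ℝ) / 2)) * (α + β) + β := by
  obtain ⟨i₀, hi₀⟩ := exists_ne_zero_of_mass_pos h
  have hcons : ∀ i j, t (c, .inl i) ≠ 0 → t (c, .inl j) ≠ 0 → j ≤ i + 1 := fun i j hi hj =>
    hσ.consecutive c i j (Finsupp.mem_support_iff.2 hi) (Finsupp.mem_support_iff.2 hj)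
  obtain ⟨i, hi, hmin⟩ : ∃ i, t (c, .inl i) ≠ 0 ∧ ∀ j, t (c, .inl j) ≠ 0 → j = i ∨ j = i + 1 := by
    by_cases h1 : t (c, .inl (i₀ - 1)) = 0
    · refine ⟨i₀, hi₀, fun j hj => ?_⟩
      have h2 := hcons _ _ hi₀ hj
      have h3 := hcons _ _ hj hi₀
      have : j ≠ i₀ - 1 := by rintro rfl; exact hj h1
      omega
    · refine ⟨i₀ - 1, h1, fun j hj => ?_⟩
      have h2 := hcons _ _ h1 hj
      have h3 := hcons _ _ hj hi₀
      omega
  have hsum : ∀ w : Vert → ℝ, (∀ d j, d ≠ c → w (d, .inl j) = 0) → (∀ d z, w (d, .inr z) = 0) →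
      Finsupp.linearCombination ℝ w t = t (c, .inl i) * w (c, .inl i) +
        t (c, .inl (i + 1)) * w (c, .inl (i + 1)) := by
    intro w h1 h2
    have hne : ((c, .inl i) : Vert) ≠ (c, .inl (i + 1)) := by simp
    rw [Finsupp.linearCombination_apply, Finsupp.sum, ← Finset.sum_pair hne (f := fun x => t x * w x)]
    rw [Finset.sum_subset (Finset.subset_union_left (s₂ := {(c, .inl i), (c, .inl (i + 1))}))]
    · symm
      refine Finset.sum_subset Finset.subset_union_right fun x hx hx' => ?_
      obtain ⟨d, j | z⟩ := x
      · by_cases hd : d = c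
        · subst hd
          have : t (d, .inl j) = 0 := by
            by_contra hj
            rcases hmin j hj with rfl | rfl <;> simp at hx'
          rw [this, zero_mul]
        · rw [h1 d j hd, mul_zero]
      · rw [h2, mul_zero]
    · intro x _ hx
      rw [Finsupp.notMem_support_iff.1 hx, zero_smul]
  refine ⟨i, t (c, .inl i), t (c, .inl (i + 1)), lt_of_le_of_ne (ht _) hi.symm, ht _, ?_, ?_, ?_⟩
  · intro j
    by_cases h1 : j = i
    · simp [h1]
    · by_cases h2 : j = i + 1
      · simp [h2]
      · rw [if_neg h1, if_neg h2]
        by_contra hj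
        rcases hmin j hj with rfl | rfl <;> contradiction
  · rw [mass, hsum]
    · simp [cycleIndicator]
    · intro d j hd; simp [cycleIndicator, hd]
    · intro d z; simp [cycleIndicator]
  · rw [moment, hsum]
    · simp only [cyclePosition, if_true]; push_cast; ring
    · intro d j hd; simp [cyclePosition, hd]
    · intro d z; simp [cyclePosition]

/-- The weight sits on two consecutive indices `i`, `i + 1`. With positive weight at `i`, this index
is the integer part of the mean position and the remaining fraction gives the two weights. -/
theorem eq_of_mass_eq_of_moment_eq {c : Bool} {t₁ t₂ : Vert →₀ ℝ} (h₁ : ∀ x, 0 ≤ t₁ x)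
    (h₂ : ∀ x, 0 ≤ t₂ x) (hσ₁ : IsSimplex n t₁.support) (hσ₂ : IsSimplex n t₂.support)
    (hmass : mass c t₁ = mass c t₂) (hmoment : moment n c t₁ = moment n c t₂) (j : ℤ) :
    t₁ (c, .inl j) = t₂ (c, .inl j) := by
  rcases (mass_nonneg (c := c) h₁).eq_or_lt with h | h
  · rw [eq_zero_of_mass_eq_zero h₁ h.symm, eq_zero_of_mass_eq_zero h₂ (hmass ▸ h.symm)]
  · obtain ⟨i, α, β, hα, hβ, hi, hm, hM⟩ := exists_eq_ite_of_mass_pos h₁ hσ₁ h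
    obtain ⟨i', α', β', hα', hβ', hi', hm', hM'⟩ := exists_eq_ite_of_mass_pos h₂ hσ₂ (hmass ▸ h)
    have e1 : α + β = α' + β' := by rw [← hm, ← hm', hmass]
    have e2 : (i : ℝ) * (α + β) + β = i' * (α + β) + β' := by
      rw [hM, hM', ← e1] at hmoment
      linarith
    obtain rfl : i = i' := by
      rcases lt_trichotomy i i' with hlt | heq | hlt
      · have : (i : ℝ) + 1 ≤ i' := by exact_mod_cast hlt
        nlinarith
      · exact heq
      · have : (i' : ℝ) + 1 ≤ i := by exact_mod_cast hlt
        nlinarith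
    have e3 : β = β' := by linarith
    have e4 : α = α' := by linarith
    rw [hi, hi', e3, e4]

/-- The apex forces `t₁` onto the lower staircase: with `I` its largest index of colour false, its
indices of colour true are at least `I - 2`. If the mean of colour true increased and that of colour
false decreased, `t₂` would have a true index above `I - 2` and a false index below `I`, outside the
strip. -/
theorem not_moment_lt_of_apex_true {t₁ t₂ : Vert →₀ ℝ} (h₁ : ∀ x, 0 ≤ t₁ x)
    (h₂ : ∀ x, 0 ≤ t₂ x) (hσ₁ : IsSimplex n t₁.support) (hσ₂ : IsSimplex n t₂.support)
    (hm : ∀ c, mass c t₁ = mass c t₂) (hpos : ∀ c, 0 < mass c t₁)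
    (hapex : t₁ (true, .inr false) ≠ 0) (hlt : moment n true t₁ < moment n true t₂) :
    ¬ moment n false t₂ < moment n false t₁ := by
  intro hlt'
  have hmem : ∀ {t : Vert →₀ ℝ} {x}, t x ≠ 0 → x ∈ t.support := Finsupp.mem_support_iff.2
  obtain ⟨i₀, hi₀⟩ := exists_ne_zero_of_mass_pos (hpos true)
  obtain ⟨j₀, hj₀⟩ := exists_ne_zero_of_mass_pos (hpos false)
  obtain ⟨I, hI, hmax⟩ := hσ₁.exists_max (hmem hj₀)
  have hle : ∀ k, t₁ (true, .inl k) ≠ 0 → I - 2 ≤ k := fun k hk => by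
    have := hσ₁.apex_true (hmem hapex) k I (hmem hk) hI
    omega
  obtain ⟨k, hk, hk'⟩ := exists_gt_of_lt_moment (I := I - 2) h₂
    (lt_of_le_of_lt (by rw [← hm]; exact le_moment h₁ hle) hlt)
  obtain ⟨j, hj, hj'⟩ := exists_lt_of_moment_lt (I := I) h₂
    (lt_of_lt_of_le hlt' (by rw [← hm]; exact moment_le h₁ fun k hk => (hmax k (hmem hk)).2))
  have := (hσ₂.bounds _ _ (hmem hk) (hmem hj)).1
  omega

/-- The mirror image at the upper staircase, now with the apex on `t₂` and the violation in `t₁`. -/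
theorem not_moment_lt_of_apex_false {t₁ t₂ : Vert →₀ ℝ} (h₁ : ∀ x, 0 ≤ t₁ x)
    (h₂ : ∀ x, 0 ≤ t₂ x) (hσ₁ : IsSimplex n t₁.support) (hσ₂ : IsSimplex n t₂.support)
    (hm : ∀ c, mass c t₁ = mass c t₂) (hpos : ∀ c, 0 < mass c t₁)
    (hapex : t₂ (false, .inr false) ≠ 0) (hlt : moment n true t₁ < moment n true t₂) :
    ¬ moment n false t₂ < moment n false t₁ := by
  intro hlt'
  have hmem : ∀ {t : Vert →₀ ℝ} {x}, t x ≠ 0 → x ∈ t.support := Finsupp.mem_support_iff.2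
  obtain ⟨i₀, hi₀⟩ := exists_ne_zero_of_mass_pos (hm true ▸ hpos true)
  obtain ⟨I, hI, hmax⟩ := hσ₂.exists_max (hmem hi₀)
  have hle : ∀ k, t₂ (false, .inl k) ≠ 0 → I + n - 2 ≤ k := fun k hk =>
    hσ₂.apex_false (hmem hapex) I k hI (hmem hk)
  obtain ⟨j, hj, hj'⟩ := exists_gt_of_lt_moment (I := I + n - 2) h₁
    (lt_of_le_of_lt (by rw [hm]; exact le_moment h₂ hle) hlt')
  obtain ⟨k, hk, hk'⟩ := exists_lt_of_moment_lt (I := I) h₁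
    (lt_of_lt_of_le hlt (by rw [hm]; exact moment_le h₂ fun k hk => (hmax k (hmem hk)).2))
  have := (hσ₁.bounds _ _ (hmem hk) (hmem hj)).2
  omega

/-- Otherwise `t₂` lies strictly further towards the lower staircase, so its fraction in the fourth
coordinate is larger. To compensate, `t₁` would need the apex of colour true or `t₂` that of colour
false, and the two preceding lemmas exclude both. -/
theorem moment_le_of_eq {t₁ t₂ : Vert →₀ ℝ} (h₁ : ∀ x, 0 ≤ t₁ x)
    (h₂ : ∀ x, 0 ≤ t₂ x) (hσ₁ : IsSimplex n t₁.support) (hσ₂ : IsSimplex n t₂.support)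
    (hm : ∀ c, mass c t₁ = mass c t₂) (hpos : ∀ c, 0 < mass c t₁)
    (hS : moment n true t₁ + moment n false t₁ = moment n true t₂ + moment n false t₂)
    (hv : (mass false t₁ * moment n true t₁ - mass true t₁ * moment n false t₁) /
        (mass true t₁ + mass false t₁) + (t₁ (true, .inr false) - t₁ (false, .inr false)) =
      (mass false t₂ * moment n true t₂ - mass true t₂ * moment n false t₂) /
        (mass true t₂ + mass false t₂) + (t₂ (true, .inr false) - t₂ (false, .inr false))) :
    moment n true t₂ ≤ moment n true t₁ := by
  by_contra! hlt
  have hlt' : moment n false t₂ < moment n false t₁ := by linarith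
  have hp := hpos true
  have hq := hpos false
  have hapex : t₁ (true, .inr false) = 0 ∧ t₂ (false, .inr false) = 0 :=
    ⟨by_contra fun h => not_moment_lt_of_apex_true h₁ h₂ hσ₁ hσ₂ hm hpos h hlt hlt',
      by_contra fun h => not_moment_lt_of_apex_false h₁ h₂ hσ₁ hσ₂ hm hpos h hlt hlt'⟩
  rw [← hm true, ← hm false, hapex.1, hapex.2] at hv
  have h3 := h₁ (false, .inr false)
  have h4 := h₂ (true, .inr false)
  have h5 : (mass false t₁ * moment n true t₁ - mass true t₁ * moment n false t₁) /
        (mass true t₁ + mass false t₁) < (mass false t₁ * moment n true t₂ -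
        mass true t₁ * moment n false t₂) / (mass true t₁ + mass false t₁) := by
    refine div_lt_div_of_pos_right ?_ (add_pos hp hq)
    nlinarith [mul_lt_mul_of_pos_left hlt hq, mul_lt_mul_of_pos_left hlt' hp]
  linarith

theorem eq_of_coordinates_eq {t₁ t₂ : Vert →₀ ℝ} (h₁ : ∀ x, 0 ≤ t₁ x)
    (h₂ : ∀ x, 0 ≤ t₂ x) (hσ₁ : IsSimplex n t₁.support) (hσ₂ : IsSimplex n t₂.support)
    (hm : ∀ c, mass c t₁ = mass c t₂) (hpole : ∀ c, t₁ (c, .inr true) = t₂ (c, .inr true))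
    (hS : moment n true t₁ + moment n false t₁ = moment n true t₂ + moment n false t₂)
    (hv : (mass false t₁ * moment n true t₁ - mass true t₁ * moment n false t₁) /
        (mass true t₁ + mass false t₁) + (t₁ (true, .inr false) - t₁ (false, .inr false)) =
      (mass false t₂ * moment n true t₂ - mass true t₂ * moment n false t₂) /
        (mass true t₂ + mass false t₂) + (t₂ (true, .inr false) - t₂ (false, .inr false))) :
    t₁ = t₂ := by
  have hM : moment n true t₁ = moment n true t₂ := by
    rcases (mass_nonneg (c := true) h₁).eq_or_lt with hp | hp
    · rw [moment_eq_zero_of_mass_eq_zero h₁ hp.symm,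
        moment_eq_zero_of_mass_eq_zero h₂ (hm true ▸ hp.symm)]
    rcases (mass_nonneg (c := false) h₁).eq_or_lt with hq | hq
    · have hq' : mass false t₂ = 0 := hm false ▸ hq.symm
      rwa [moment_eq_zero_of_mass_eq_zero h₁ hq.symm,
        moment_eq_zero_of_mass_eq_zero h₂ hq', add_zero, add_zero] at hS
    have hpos : ∀ c, 0 < mass c t₁ := by rintro (_ | _) <;> assumption
    exact le_antisymm
      (moment_le_of_eq h₂ h₁ hσ₂ hσ₁ (fun c => (hm c).symm) (fun c => hm c ▸ hpos c) hS.symm hv.symm)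
      (moment_le_of_eq h₁ h₂ hσ₁ hσ₂ hm hpos hS hv)
  have hM' : ∀ c, moment n c t₁ = moment n c t₂ := by
    rintro (_ | _)
    · linarith
    · exact hM
  have hdiff : t₁ (true, .inr false) - t₁ (false, .inr false) =
      t₂ (true, .inr false) - t₂ (false, .inr false) := by
    rw [hm, hm, hM', hM'] at hv
    linarith
  have hor : ∀ {t : Vert →₀ ℝ}, IsSimplex n t.support →
      t (true, .inr false) = 0 ∨ t (false, .inr false) = 0 := fun {t} hσ => by
    by_contra! hc
    exact hσ.not_both false (Finsupp.mem_support_iff.2 hc.1) (Finsupp.mem_support_iff.2 hc.2)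
  have e1 := h₁ (true, .inr false)
  have e2 := h₁ (false, .inr false)
  have e3 := h₂ (true, .inr false)
  have e4 := h₂ (false, .inr false)
  have hapex : ∀ c, t₁ (c, .inr false) = t₂ (c, .inr false) := by
    rcases hor hσ₁ with a | a <;> rcases hor hσ₂ with b | b <;> rintro (_ | _) <;> linarith
  ext ⟨c, i | z⟩
  · exact eq_of_mass_eq_of_moment_eq h₁ h₂ hσ₁ hσ₂ (hm c) (hM' c) i
  · cases z
    · exact hapex c
    · exact hpole c

theorem mass_zpow (l : ℤ) (c : Bool) (t : Vert →₀ ℝ) :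
    mass c (t.equivMapDomain (antipode n ^ (2 * l))) = mass c t := by
  rw [mass, Finsupp.linearCombination_equivMapDomain]
  congr 2
  ext ⟨d, i | z⟩
  · simp [antipode_zpow_even_inl, cycleIndicator]
  · simp [antipode_zpow_even_inr]

theorem moment_zpow (l : ℤ) (c : Bool) (t : Vert →₀ ℝ) :
    moment n c (t.equivMapDomain (antipode n ^ (2 * l))) = moment n c t - l * n * mass c t := by
  rw [moment, mass, Finsupp.linearCombination_equivMapDomain,
    Finsupp.linearCombination_apply, Finsupp.linearCombination_apply,
    Finsupp.linearCombination_apply, Finsupp.mul_sum, ← Finsupp.sum_sub]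
  refine Finsupp.sum_congr fun x _ => ?_
  obtain ⟨d, i | z⟩ := x
  · by_cases hd : d = c
    · simp [antipode_zpow_even_inl, cycleIndicator, cyclePosition, hd]; ring
    · simp [antipode_zpow_even_inl, cycleIndicator, cyclePosition, hd]
  · simp [antipode_zpow_even_inr, cycleIndicator, cyclePosition]

theorem inr_zpow (l : ℤ) (c z : Bool) (t : Vert →₀ ℝ) :
    t.equivMapDomain (antipode n ^ (2 * l)) (c, .inr z) = t (c, .inr z) := by
  rw [Finsupp.equivMapDomain_apply]
  congr 1
  rw [Equiv.symm_apply_eq, antipode_zpow_even_inr]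

/-- The angles are compared after multiplication by `r`, which also covers points on the axis, where
the angle is undetermined. -/
theorem polarPoint_inj (hn : n ≠ 0) {r r' θ θ' u u' v v' : ℝ} (hr : 0 ≤ r) (hr' : 0 ≤ r')
    (h : polarPoint n r θ u v = polarPoint n r' θ' u' v') :
    r = r' ∧ u = u' ∧ v = v' ∧ ∃ l : ℤ, r * θ - l * n * r = r * θ' := by
  have h0 : r * Real.cos (2 * Real.pi / n * θ) = r' * Real.cos (2 * Real.pi / n * θ') :=
    congrArg (fun x : EuclideanSpace ℝ (Fin 4) => x 0) h
  have h1 : r * Real.sin (2 * Real.pi / n * θ) = r' * Real.sin (2 * Real.pi / n * θ') :=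
    congrArg (fun x : EuclideanSpace ℝ (Fin 4) => x 1) h
  have h2 : u = u' := congrArg (fun x : EuclideanSpace ℝ (Fin 4) => x 2) h
  have h3 : v = v' := congrArg (fun x : EuclideanSpace ℝ (Fin 4) => x 3) h
  have hrr : r = r' := by
    refine (sq_eq_sq₀ hr hr').1 ?_
    have e1 := Real.cos_sq_add_sin_sq (2 * Real.pi / n * θ)
    have e2 := Real.cos_sq_add_sin_sq (2 * Real.pi / n * θ')
    calc r ^ 2 = (r * Real.cos (2 * Real.pi / n * θ)) ^ 2 +
          (r * Real.sin (2 * Real.pi / n * θ)) ^ 2 := by rw [mul_pow, mul_pow, ← mul_add, e1, mul_one]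
      _ = r' ^ 2 := by rw [h0, h1, mul_pow, mul_pow, ← mul_add, e2, mul_one]
  subst hrr
  refine ⟨rfl, h2, h3, ?_⟩
  rcases hr.eq_or_lt with rfl | hpos
  · exact ⟨0, by simp⟩
  · obtain ⟨k, hk⟩ := Real.Angle.angle_eq_iff_two_pi_dvd_sub.1
      (Real.Angle.cos_sin_inj (mul_left_cancel₀ hpos.ne' h0) (mul_left_cancel₀ hpos.ne' h1))
    refine ⟨k, ?_⟩
    have hn' : (n : ℝ) ≠ 0 := by exact_mod_cast hn
    have hpi := Real.pi_ne_zero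
    have : θ - θ' = k * n := by
      field_simp at hk
      linarith
    rw [show θ = θ' + k * n by linarith]
    ring

theorem IsSimplex.mul_eq_zero {t : Vert →₀ ℝ} (ht : ∀ x, 0 ≤ t x) (hσ : IsSimplex n t.support)
    (c : Bool) : t (c, .inr true) = 0 ∨ mass c t = 0 := by
  by_contra! hc
  obtain ⟨i, hi⟩ := exists_ne_zero_of_mass_pos (lt_of_le_of_ne (mass_nonneg ht) hc.2.symm)
  exact hσ.pole c i (Finsupp.mem_support_iff.2 hc.1) (Finsupp.mem_support_iff.2 hi)

theorem IsSimplex.eq_zero_or_eq_zero {t : Vert →₀ ℝ} (hσ : IsSimplex n t.support) (z : Bool) :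
    t (true, .inr z) = 0 ∨ t (false, .inr z) = 0 := by
  by_contra! hc
  exact hσ.not_both z (Finsupp.mem_support_iff.2 hc.1) (Finsupp.mem_support_iff.2 hc.2)

theorem exists_zpow_of_toSpace_eq (hn : n ≠ 0) {t₁ t₂ : Vert →₀ ℝ} (h₁ : ∀ x, 0 ≤ t₁ x)
    (h₂ : ∀ x, 0 ≤ t₂ x) (hσ₁ : IsSimplex n t₁.support) (hσ₂ : IsSimplex n t₂.support)
    (h : toSpace n t₁ = toSpace n t₂) :
    ∃ l : ℤ, t₂ = t₁.equivMapDomain (antipode n ^ (2 * l)) := by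
  have p₁ := mass_nonneg (c := true) h₁
  have q₁ := mass_nonneg (c := false) h₁
  have p₂ := mass_nonneg (c := true) h₂
  have q₂ := mass_nonneg (c := false) h₂
  obtain ⟨hr, hu, hv, l, hl⟩ := polarPoint_inj hn (add_nonneg p₁ q₁) (add_nonneg p₂ q₂) h
  have b₁ := h₁ (true, .inr true)
  have b₁' := h₁ (false, .inr true)
  have b₂ := h₂ (true, .inr true)
  have b₂' := h₂ (false, .inr true)
  -- Here `r = p + q` and `u = q - p + b - b'`, where a positive pole weight `b` forces `p = b' = 0`
  -- and a positive `b'` forces `q = b = 0`. So the position of `u` relative to `-r` and `r`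
  -- determines all four.
  have hall : mass true t₁ = mass true t₂ ∧ mass false t₁ = mass false t₂ ∧
      t₁ (true, .inr true) = t₂ (true, .inr true) ∧
      t₁ (false, .inr true) = t₂ (false, .inr true) := by
    have a1 := hσ₁.mul_eq_zero h₁ true
    have a2 := hσ₁.mul_eq_zero h₁ false
    have a3 := hσ₁.eq_zero_or_eq_zero true
    have a4 := hσ₂.mul_eq_zero h₂ true
    have a5 := hσ₂.mul_eq_zero h₂ false
    have a6 := hσ₂.eq_zero_or_eq_zero true
    clear hv hl h
    generalize mass true t₁ = p at *
    generalize mass false t₁ = q at *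
    generalize mass true t₂ = p' at *
    generalize mass false t₂ = q' at *
    generalize t₁ (true, .inr true) = b at *
    generalize t₁ (false, .inr true) = b' at *
    generalize t₂ (true, .inr true) = d at *
    generalize t₂ (false, .inr true) = d' at *
    rcases a1 with a1 | a1 <;> rcases a2 with a2 | a2 <;> rcases a3 with a3 | a3 <;>
      rcases a4 with a4 | a4 <;> rcases a5 with a5 | a5 <;> rcases a6 with a6 | a6 <;>
      refine ⟨?_, ?_, ?_, ?_⟩ <;> linarith
  obtain ⟨hp, hq, hb, hb'⟩ := hall
  have hm : ∀ c, mass c t₁ = mass c t₂ := by rintro (_ | _) <;> assumption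
  have hS : moment n true t₁ + moment n false t₁ - l * n * (mass true t₁ + mass false t₁) =
      moment n true t₂ + moment n false t₂ := by
    rcases (add_nonneg p₁ q₁).eq_or_lt with h0 | h0
    · have z₁ : mass true t₁ = 0 := by linarith
      have z₂ : mass false t₁ = 0 := by linarith
      rw [moment_eq_zero_of_mass_eq_zero h₁ z₁, moment_eq_zero_of_mass_eq_zero h₁ z₂,
        moment_eq_zero_of_mass_eq_zero h₂ (hp ▸ z₁), moment_eq_zero_of_mass_eq_zero h₂ (hq ▸ z₂),
        z₁, z₂]
      simp
    · rw [← hr, mul_div_cancel₀ _ h0.ne', mul_div_cancel₀ _ h0.ne'] at hl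
      exact hl
  refine ⟨l, (eq_of_coordinates_eq (n := n) (fun x => ?_) h₂ ?_ hσ₂ (fun c => ?_) ?_ ?_ ?_).symm⟩
  · rw [Finsupp.equivMapDomain_apply]; exact h₁ _
  · rwa [support_equivMapDomain_eq_smul, isSimplex_zpow_smul_iff]
  · rw [mass_zpow, hm]
  · rintro (_ | _) <;> rw [inr_zpow] <;> assumption
  · rw [moment_zpow, moment_zpow, ← hS]
    ring
  · rw [mass_zpow, mass_zpow, moment_zpow, moment_zpow, inr_zpow, inr_zpow, ← hv]
    congr 2
    ring

theorem toSpace_zero : toSpace n 0 = 0 := by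
  ext i
  fin_cases i <;> simp [toSpace, polarPoint]

theorem toSpace_ne_zero (hn : n ≠ 0) {t : Vert →₀ ℝ} (ht : ∀ x, 0 ≤ t x)
    (hσ : IsSimplex n t.support) : toSpace n t ≠ 0 := by
  intro h
  have p := mass_nonneg (c := true) ht
  have q := mass_nonneg (c := false) ht
  have h0 : toSpace n t = polarPoint n 0 0 0 0 := by
    rw [h]
    ext i
    fin_cases i <;> simp [polarPoint]
  obtain ⟨hr, hu, hv, -⟩ := polarPoint_inj hn (add_nonneg p q) le_rfl h0
  have hp : mass true t = 0 := by linarith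
  have hq : mass false t = 0 := by linarith
  rw [hp, hq] at hu hv
  simp only [sub_self, zero_add, zero_mul, zero_div] at hu hv
  obtain ⟨x, hx⟩ := hσ.nonempty
  refine Finsupp.mem_support_iff.1 hx ?_
  have hz : ∀ z, t (true, .inr z) - t (false, .inr z) = 0 := by
    rintro (_ | _) <;> assumption
  obtain ⟨c, i | z⟩ := x
  · exact eq_zero_of_mass_eq_zero ht (by cases c <;> assumption) i
  · have := hz z
    rcases hσ.eq_zero_or_eq_zero z with h | h <;> cases c <;> linarith

theorem exists_zpow_of_toSpace_eq_smul (hn : n ≠ 0) {t₁ t₂ : Vert →₀ ℝ} (h₁ : ∀ x, 0 ≤ t₁ x)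
    (hσ₁ : IsSimplex n t₁.support) (hs₁ : (t₁.sum fun _ r => r) = 1) (h₂ : ∀ x, 0 ≤ t₂ x)
    (hσ₂ : IsSimplex n t₂.support) (hs₂ : (t₂.sum fun _ r => r) = 1) {c : ℝ}
    (h : toSpace n t₁ = c • toSpace n t₂) :
    ∃ k : ℤ, t₂ = t₁.equivMapDomain (antipode n ^ k) := by
  have aux : ∀ (t : Vert →₀ ℝ), (∀ x, 0 ≤ t x) → IsSimplex n t.support →
      (t.sum fun _ r => r) = 1 → ∀ c : ℝ, 0 < c → toSpace n t₁ = c • toSpace n t →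
      ∃ l : ℤ, t = t₁.equivMapDomain (antipode n ^ (2 * l)) := by
    intro t ht hσ hs c hc h
    rw [← toSpace_smul hc] at h
    obtain ⟨l, hl⟩ := exists_zpow_of_toSpace_eq hn h₁ (fun x => mul_nonneg hc.le (ht x)) hσ₁
      (by rwa [Finsupp.support_smul_eq hc.ne']) h
    have hsum : c = 1 := by
      have := congrArg (fun t : Vert →₀ ℝ => t.sum fun _ r => r) hl
      simp only [sum_equivMapDomain, hs₁] at this
      rw [Finsupp.sum_smul_index fun _ => rfl, ← Finsupp.mul_sum, hs, mul_one] at this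
      exact this
    rw [hsum, one_smul] at hl
    exact ⟨l, hl⟩
  -- A negative factor is made positive by applying the antipode to `t₂`, which gives an odd power.
  rcases lt_trichotomy c 0 with hc | hc | hc
  · obtain ⟨l, hl⟩ := aux (t₂.equivMapDomain (antipode n))
      (fun x => by rw [Finsupp.equivMapDomain_apply]; exact h₂ _)
      (by rwa [support_equivMapDomain_eq_smul, isSimplex_smul_iff])
      (by rw [sum_equivMapDomain, hs₂]) (-c) (by linarith)
      (by rw [toSpace_antipode hn, h]; simp)
    refine ⟨2 * l - 1, ?_⟩
    ext x
    have := DFunLike.congr_fun hl (antipode n x)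
    rw [Finsupp.equivMapDomain_apply, Equiv.symm_apply_apply, Finsupp.equivMapDomain_apply] at this
    rw [this, Finsupp.equivMapDomain_apply]
    congr 1
    have hg : ∀ y, (antipode n ^ (2 * l)) y = antipode n ((antipode n ^ (2 * l - 1)) y) := by
      intro y
      rw [← Equiv.Perm.mul_apply, ← zpow_one_add]
      congr 2
      ring
    rw [Equiv.symm_apply_eq, hg, Equiv.apply_symm_apply]
  · rw [hc, zero_smul] at h
    exact absurd h (toSpace_ne_zero hn h₁ hσ₁)
  · obtain ⟨l, hl⟩ := aux t₂ h₂ hσ₂ hs₂ c hc h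
    exact ⟨_, hl⟩

/-! ### Surjectivity onto the lines of `ℝ⁴` -/

/-- Weight `p` at the point `x` of the cycle of colour `c`. -/
noncomputable def spread (c : Bool) (p x : ℝ) : Vert →₀ ℝ :=
  Finsupp.single (c, .inl ⌊x⌋) (p * (1 - Int.fract x)) +
    Finsupp.single (c, .inl (⌊x⌋ + 1)) (p * Int.fract x)

theorem spread_nonneg {c : Bool} {p x : ℝ} (hp : 0 ≤ p) (y : Vert) : 0 ≤ spread c p x y := by
  have h1 := Int.fract_nonneg x
  have h2 := (Int.fract_lt_one x).le
  rw [spread, Finsupp.add_apply, Finsupp.single_apply, Finsupp.single_apply]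
  refine add_nonneg ?_ ?_ <;> split_ifs
  · exact mul_nonneg hp (by linarith)
  · rfl
  · exact mul_nonneg hp h1
  · rfl

theorem spread_ne_zero {c : Bool} {p x : ℝ} {y : Vert} (h : spread c p x y ≠ 0) :
    p ≠ 0 ∧ ∃ k, y = (c, .inl k) ∧ ⌊x⌋ ≤ k ∧ k ≤ ⌈x⌉ := by
  rw [spread, Finsupp.add_apply, Finsupp.single_apply, Finsupp.single_apply] at h
  refine ⟨by rintro rfl; simp at h, ?_⟩
  by_cases h1 : (c, .inl ⌊x⌋) = y
  · exact ⟨⌊x⌋, h1.symm, le_rfl, Int.floor_le_ceil x⟩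
  · by_cases h2 : (c, .inl (⌊x⌋ + 1)) = y
    · refine ⟨⌊x⌋ + 1, h2.symm, by omega, ?_⟩
      rw [Int.add_one_le_iff, Int.lt_ceil]
      have h3 : Int.fract x ≠ 0 := by
        intro h0
        simp [h1, h2, h0] at h
      have h4 := lt_of_le_of_ne (Int.fract_nonneg x) h3.symm
      have := Int.floor_add_fract x
      linarith
    · simp [h1, h2] at h

theorem mass_spread (c d : Bool) (p x : ℝ) : mass d (spread c p x) = if c = d then p else 0 := by
  rw [spread, map_add, mass, Finsupp.linearCombination_single, Finsupp.linearCombination_single]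
  by_cases h : c = d
  · simp [cycleIndicator, h]; ring
  · simp [cycleIndicator, h]

theorem moment_spread (c d : Bool) (p x : ℝ) : moment n d (spread c p x) =
    if c = d then p * (x - if d then 0 else (n : ℝ) / 2) else 0 := by
  rw [spread, map_add, moment, Finsupp.linearCombination_single, Finsupp.linearCombination_single]
  by_cases h : c = d
  · simp only [cyclePosition, h, if_true, smul_eq_mul]
    have := Int.floor_add_fract x
    conv_rhs => rw [← this]
    push_cast
    ring
  · simp [cyclePosition, h]

/-- A point with weights on both cycles, both apices and the first pole. -/
noncomputable def configuration (p x q y a a' b : ℝ) : Vert →₀ ℝ :=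
  spread true p x + spread false q y + Finsupp.single (true, .inr false) a +
    Finsupp.single (false, .inr false) a' + Finsupp.single (true, .inr true) b

theorem mass_single_inr (c d z : Bool) (r : ℝ) :
    mass c (Finsupp.single (d, .inr z) r) = 0 := by
  rw [mass, Finsupp.linearCombination_single]
  simp [cycleIndicator]

theorem moment_single_inr (c d z : Bool) (r : ℝ) :
    moment n c (Finsupp.single (d, .inr z) r) = 0 := by
  rw [moment, Finsupp.linearCombination_single]
  simp [cyclePosition]

theorem spread_inr (c d z : Bool) (p x : ℝ) : spread c p x (d, .inr z) = 0 := by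
  simp [spread]

theorem configuration_inl (p x q y a a' b : ℝ) (c : Bool) (k : ℤ) :
    configuration p x q y a a' b (c, .inl k) =
      if c then spread true p x (c, .inl k) else spread false q y (c, .inl k) := by
  cases c <;> simp [configuration, spread]

theorem configuration_inr (p x q y a a' b : ℝ) (c z : Bool) :
    configuration p x q y a a' b (c, .inr z) =
      if z then (if c then b else 0) else (if c then a else a') := by
  cases c <;> cases z <;> simp [configuration, spread_inr]

theorem toSpace_configuration (p x q y a a' b : ℝ) :
    toSpace n (configuration p x q y a a' b) =
      polarPoint n (p + q) ((p * x + q * (y - n / 2)) / (p + q)) (q - p + b)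
        ((q * (p * x) - p * (q * (y - n / 2))) / (p + q) + (a - a')) := by
  have hm : ∀ c, mass c (configuration p x q y a a' b) = if c then p else q := by
    intro c
    simp only [configuration, map_add, mass_single_inr, mass_spread]
    cases c <;> simp
  have hM : ∀ c, moment n c (configuration p x q y a a' b) =
      if c then p * x else q * (y - n / 2) := by
    intro c
    simp only [configuration, map_add, moment_single_inr, moment_spread]
    cases c <;> simp
  simp [toSpace, hm, hM, configuration_inr]

theorem configuration_nonneg {p x q y a a' b : ℝ} (hp : 0 ≤ p) (hq : 0 ≤ q) (ha : 0 ≤ a)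
    (ha' : 0 ≤ a') (hb : 0 ≤ b) (v : Vert) : 0 ≤ configuration p x q y a a' b v := by
  obtain ⟨c, k | z⟩ := v
  · rw [configuration_inl]
    split_ifs
    · exact spread_nonneg hp _
    · exact spread_nonneg hq _
  · rw [configuration_inr]
    split_ifs <;> first | assumption | rfl

/-- When both cycles carry mass only the apex of colour true is allowed; the upper staircase is
reached later through the antipode. -/
theorem isSimplex_configuration {p x q y a a' b : ℝ} (hne : configuration p x q y a a' b ≠ 0)
    (ha : a = 0 ∨ a' = 0) (hb : b = 0 ∨ p = 0)
    (h : p ≠ 0 → q ≠ 0 → ⌈x⌉ + 1 ≤ ⌊y⌋ ∧ ⌈y⌉ ≤ ⌊x⌋ + n - 1 ∧ (a ≠ 0 → ⌈y⌉ ≤ ⌊x⌋ + 2) ∧ a' = 0) :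
    IsSimplex n (configuration p x q y a a' b).support := by
  have ht : ∀ k, (true, .inl k) ∈ (configuration p x q y a a' b).support →
      p ≠ 0 ∧ ⌊x⌋ ≤ k ∧ k ≤ ⌈x⌉ := by
    intro k hk
    rw [Finsupp.mem_support_iff, configuration_inl, if_pos rfl] at hk
    obtain ⟨h1, l, h2, h3⟩ := spread_ne_zero hk
    obtain rfl : k = l := by simpa using h2
    exact ⟨h1, h3⟩
  have hf : ∀ k, (false, .inl k) ∈ (configuration p x q y a a' b).support →
      q ≠ 0 ∧ ⌊y⌋ ≤ k ∧ k ≤ ⌈y⌉ := by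
    intro k hk
    rw [Finsupp.mem_support_iff, configuration_inl, if_neg (by simp)] at hk
    obtain ⟨h1, l, h2, h3⟩ := spread_ne_zero hk
    obtain rfl : k = l := by simpa using h2
    exact ⟨h1, h3⟩
  have hx := Int.ceil_le_floor_add_one x
  have hy := Int.ceil_le_floor_add_one y
  refine ⟨Finsupp.support_nonempty_iff.2 hne, ?_, ?_, ?_, ?_, ?_, ?_⟩
  · rintro (_ | _) i j hi hj
    · have := hf i hi
      have := hf j hj
      omega
    · have := ht i hi
      have := ht j hj
      omega
  · intro i j hi hj
    obtain ⟨hp, hi⟩ := ht i hi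
    obtain ⟨hq, hj⟩ := hf j hj
    have := h hp hq
    omega
  · rintro (_ | _) h1 h2 <;>
      simp only [Finsupp.mem_support_iff, configuration_inr] at h1 h2
    · rcases ha with rfl | rfl <;> simp at h1 h2
    · simp at h2
  · intro ha i j hi hj
    obtain ⟨hp, hi⟩ := ht i hi
    obtain ⟨hq, hj⟩ := hf j hj
    have := (h hp hq).2.2.1 (by simpa [configuration_inr] using ha)
    omega
  · intro ha i j hi hj
    obtain ⟨hp, hi⟩ := ht i hi
    obtain ⟨hq, hj⟩ := hf j hj
    have := (h hp hq).2.2.2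
    simp [configuration_inr, this] at ha
  · rintro (_ | _) i hp hi
    · simp [configuration_inr] at hp
    · have h1 : b ≠ 0 := by simpa [configuration_inr] using hp
      exact (ht i hi).1 (hb.resolve_left h1)

/-- Moving `x` down and `y` up until the pair reaches the staircase. -/
theorem exists_staircase {p q x y : ℝ} (hp : 0 < p) (hq : 0 < q) (h : ¬ ⌈x⌉ + 1 ≤ ⌊y⌋) :
    ∃ τ, 0 < τ ∧ ⌈x - q * τ⌉ + 1 ≤ ⌊y + p * τ⌋ ∧ ⌈y + p * τ⌉ ≤ ⌊x - q * τ⌋ + 2 := by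
  have hcrit : ∀ τ : ℝ, ∀ k l : ℤ, x - q * τ ≤ k → k + 1 ≤ y + p * τ → l ≤ x - q * τ →
      y + p * τ ≤ l + 2 →
      0 < τ ∧ ⌈x - q * τ⌉ + 1 ≤ ⌊y + p * τ⌋ ∧ ⌈y + p * τ⌉ ≤ ⌊x - q * τ⌋ + 2 := by
    intro τ k l h1 h2 h3 h4
    refine ⟨?_, ?_, ?_⟩
    · by_contra hτ
      refine h ?_
      have e1 : ⌈x⌉ ≤ k := Int.ceil_le.2 (by nlinarith)
      have e2 : k + 1 ≤ ⌊y⌋ := Int.le_floor.2 (by push_cast; nlinarith)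
      omega
    · have e1 : ⌈x - q * τ⌉ ≤ k := Int.ceil_le.2 h1
      have e2 : k + 1 ≤ ⌊y + p * τ⌋ := Int.le_floor.2 (by push_cast; exact h2)
      omega
    · have e1 : l ≤ ⌊x - q * τ⌋ := Int.le_floor.2 h3
      have e2 : ⌈y + p * τ⌉ ≤ l + 2 := Int.ceil_le.2 (by push_cast; exact h4)
      omega
  -- At `τ₀` the moving point crosses the line `y = x + 1`, with first coordinate in `(k - 1, k]`.
  -- From there it meets the staircase as soon as the second coordinate reaches `k + 1` (at `τ₁`) or
  -- the first reaches `k - 1` (at `τ₂`), whichever comes earlier.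
  obtain ⟨τ₀, hτ₀⟩ : ∃ τ₀ : ℝ, (p + q) * τ₀ = x + 1 - y :=
    ⟨(x + 1 - y) / (p + q), mul_div_cancel₀ _ (add_pos hp hq).ne'⟩
  obtain ⟨k, hk1, hk2⟩ : ∃ k : ℤ, x - q * τ₀ ≤ k ∧ (k : ℝ) - 1 < x - q * τ₀ :=
    ⟨⌈x - q * τ₀⌉, Int.le_ceil _, by linarith [Int.ceil_lt_add_one (x - q * τ₀)]⟩
  obtain ⟨τ₁, hτ₁⟩ : ∃ τ₁ : ℝ, p * τ₁ = k + 1 - y := ⟨(k + 1 - y) / p, mul_div_cancel₀ _ hp.ne'⟩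
  obtain ⟨τ₂, hτ₂⟩ : ∃ τ₂ : ℝ, q * τ₂ = x - (k - 1) :=
    ⟨(x - (k - 1)) / q, mul_div_cancel₀ _ hq.ne'⟩
  have h1 : τ₀ ≤ τ₁ := by nlinarith
  have h2 : τ₀ ≤ τ₂ := by nlinarith
  rcases le_total τ₁ τ₂ with h3 | h3
  · refine ⟨τ₁, hcrit τ₁ k (k - 1) ?_ ?_ ?_ ?_⟩ <;> push_cast <;> nlinarith
  · refine ⟨τ₂, hcrit τ₂ (k - 1) (k - 1) ?_ ?_ ?_ ?_⟩ <;> push_cast <;> nlinarith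

theorem exists_toSpace_eq_of_le (r θ u v : ℝ) (hr : 0 ≤ r) (hu : r ≤ u)
    (h0 : polarPoint n r θ u v ≠ 0) :
    ∃ t : Vert →₀ ℝ, (∀ x, 0 ≤ t x) ∧ IsSimplex n t.support ∧
      toSpace n t = polarPoint n r θ u v := by
  -- For `r ≤ u` only the cycle of colour false is needed: the pole takes the excess `u - r`, and
  -- the apices take the positive and negative parts of `v`.
  have key : toSpace n (configuration 0 0 r (θ + n / 2) (max v 0) (max (-v) 0) (u - r)) =
      polarPoint n r θ u v := by
    rw [toSpace_configuration]
    have hv : max v 0 - max (-v) 0 = v := by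
      rcases le_total 0 v with h | h
      · rw [max_eq_left h, max_eq_right (by linarith)]; ring
      · rw [max_eq_right h, max_eq_left (by linarith)]; ring
    rcases hr.eq_or_lt with rfl | hr
    · rw [hv]
      ext i
      fin_cases i <;> simp [polarPoint]
    · rw [hv]
      congr 1
      · ring
      · field_simp; ring
      · ring
      · ring
  refine ⟨_, configuration_nonneg le_rfl hr (le_max_right _ _) (le_max_right _ _)
    (by linarith), isSimplex_configuration ?_ ?_ (.inr rfl) (fun h => absurd rfl h), key⟩
  · intro h
    rw [h, toSpace_zero] at key
    exact h0 key.symm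
  · rcases le_total 0 v with h | h
    · right; rw [max_eq_right]; linarith
    · left; rw [max_eq_right]; exact h

theorem exists_toSpace_eq_of_pos (hn : 3 ≤ n) {p q : ℝ} (hp : 0 < p) (hq : 0 < q) (x y : ℝ)
    (h : ⌈x⌉ + 1 ≤ ⌊y⌋ → ⌈y⌉ ≤ ⌊x⌋ + n - 1) :
    ∃ t : Vert →₀ ℝ, (∀ x, 0 ≤ t x) ∧ IsSimplex n t.support ∧
      toSpace n t = polarPoint n (p + q) ((p * x + q * (y - n / 2)) / (p + q)) (q - p)
        ((q * (p * x) - p * (q * (y - n / 2))) / (p + q)) := by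
  obtain ⟨τ, hτ, h1, h2, h3⟩ : ∃ τ, 0 ≤ τ ∧ ⌈x - q * τ⌉ + 1 ≤ ⌊y + p * τ⌋ ∧
      ⌈y + p * τ⌉ ≤ ⌊x - q * τ⌋ + n - 1 ∧ (τ ≠ 0 → ⌈y + p * τ⌉ ≤ ⌊x - q * τ⌋ + 2) := by
    by_cases hL : ⌈x⌉ + 1 ≤ ⌊y⌋
    · exact ⟨0, le_rfl, by simpa using hL, by simpa using h hL, by simp⟩
    · obtain ⟨τ, h0, h1, h2⟩ := exists_staircase hp hq hL
      exact ⟨τ, h0.le, h1, by omega, fun _ => h2⟩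
  -- The move by `τ` preserves the weighted mean angle and lowers the fourth coordinate by `pqτ`,
  -- which is exactly the weight given to the apex.
  have key : toSpace n (configuration p (x - q * τ) q (y + p * τ) (p * q * τ) 0 0) =
      polarPoint n (p + q) ((p * x + q * (y - n / 2)) / (p + q)) (q - p)
        ((q * (p * x) - p * (q * (y - n / 2))) / (p + q)) := by
    rw [toSpace_configuration]
    have : p + q ≠ 0 := by positivity
    congr 1
    · ring
    · ring
    · field_simp; ring
  refine ⟨_, configuration_nonneg hp.le hq.le (by positivity) le_rfl le_rfl,
    isSimplex_configuration ?_ (.inr rfl) (.inl rfl) fun _ _ => ⟨h1, h2, fun h0 => h3 ?_, rfl⟩, key⟩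
  · intro h0
    have hm : mass true (configuration p (x - q * τ) q (y + p * τ) (p * q * τ) 0 0) = p := by
      simp only [configuration, map_add, mass_single_inr, mass_spread]
      simp
    rw [h0, map_zero] at hm
    exact hp.ne hm
  · exact right_ne_zero_of_mul h0

theorem exists_polarPoint_eq (hn : n ≠ 0) (P : EuclideanSpace ℝ (Fin 4)) :
    ∃ r θ u v, 0 ≤ r ∧ P = polarPoint n r θ u v := by
  have hn' : (n : ℝ) ≠ 0 := by exact_mod_cast hn
  have hpi := Real.pi_ne_zero
  let z : ℂ := ⟨P 0, P 1⟩
  refine ⟨‖z‖, n / (2 * Real.pi) * Complex.arg z, P 2, P 3, norm_nonneg _, ?_⟩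
  have h : 2 * Real.pi / n * (n / (2 * Real.pi) * Complex.arg z) = Complex.arg z := by
    field_simp
  ext i
  fin_cases i
  · simp [polarPoint, h, Complex.norm_mul_cos_arg, z]
  · simp [polarPoint, h, Complex.norm_mul_sin_arg, z]
  · simp [polarPoint]
  · simp [polarPoint]

theorem exists_toSpace_eq_or_neg (hn : 3 ≤ n) {P : EuclideanSpace ℝ (Fin 4)} (hP : P ≠ 0) :
    ∃ t : Vert →₀ ℝ, (∀ x, 0 ≤ t x) ∧ IsSimplex n t.support ∧
      (toSpace n t = P ∨ toSpace n t = -P) := by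
  have hn0 : n ≠ 0 := by omega
  obtain ⟨r, θ, u, v, hr, rfl⟩ := exists_polarPoint_eq hn0 P
  by_cases h1 : r ≤ u
  · obtain ⟨t, h2, h3, h4⟩ := exists_toSpace_eq_of_le r θ u v hr h1 hP
    exact ⟨t, h2, h3, .inl h4⟩
  by_cases h2 : r ≤ -u
  · rw [← neg_ne_zero, neg_polarPoint hn0] at hP
    obtain ⟨t, h3, h4, h5⟩ := exists_toSpace_eq_of_le _ _ _ _ hr h2 hP
    exact ⟨t, h3, h4, .inr (by rw [h5, neg_polarPoint hn0])⟩
  push Not at h1 h2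
  -- In the remaining region `-r < u < r` the masses are forced by `r = p + q` and `u = q - p`, and
  -- both are positive.
  obtain ⟨p, rfl⟩ : ∃ p, r = p + (p + u) := ⟨(r - u) / 2, by ring⟩
  obtain ⟨q, rfl⟩ : ∃ q, u = q - p := ⟨u + p, by ring⟩
  have hp : 0 < p := by linarith
  have hq : 0 < q := by linarith
  rw [add_sub_cancel] at *
  have hpq : p + q ≠ 0 := by positivity
  obtain ⟨x, y, hθ, hv⟩ : ∃ x y, (p * x + q * (y - n / 2)) / (p + q) = θ ∧
      (q * (p * x) - p * (q * (y - n / 2))) / (p + q) = v := by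
    refine ⟨θ + v / p, θ + n / 2 - v / q, ?_, ?_⟩
    · field_simp; ring
    · field_simp; ring
  by_cases h3 : ⌈x⌉ + 1 ≤ ⌊y⌋ → ⌈y⌉ ≤ ⌊x⌋ + n - 1
  · obtain ⟨t, h4, h5, h6⟩ := exists_toSpace_eq_of_pos hn hp hq x y h3
    exact ⟨t, h4, h5, .inl (by rw [h6, hθ, hv])⟩
  · push Not at h3
    -- The pair `(x, y)` leaves the strip through the upper staircase. The antipode exchanges the
    -- masses and turns the pair into `(y - n, x)`, which is off the strip at the lower staircase.
    obtain ⟨t, h4, h5, h6⟩ := exists_toSpace_eq_of_pos hn hq hp (y - n) x (fun h => by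
      rw [Int.ceil_sub_intCast] at h
      omega)
    refine ⟨t, h4, h5, .inr ?_⟩
    rw [h6, neg_polarPoint hn0, ← hθ, ← hv]
    congr 1
    · ring
    · field_simp; ring
    · ring
    · field_simp; ring

theorem exists_toSpace_eq_smul (hn : 3 ≤ n) {P : EuclideanSpace ℝ (Fin 4)} (hP : P ≠ 0) :
    ∃ t : Vert →₀ ℝ, (∀ x, 0 ≤ t x) ∧ IsSimplex n t.support ∧ (t.sum fun _ r => r) = 1 ∧
      ∃ c : ℝ, toSpace n t = c • P := by
  obtain ⟨t, h1, h2, h3⟩ := exists_toSpace_eq_or_neg hn hP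
  have hpos : 0 < t.sum fun _ r => r :=
    Finset.sum_pos (fun x hx => lt_of_le_of_ne (h1 x) (Finsupp.mem_support_iff.1 hx).symm)
      h2.nonempty
  set S := t.sum fun _ r => r with hS
  have hS' : 0 < S⁻¹ := inv_pos.2 hpos
  refine ⟨S⁻¹ • t, fun x => mul_nonneg hS'.le (h1 x), ?_, ?_, ?_⟩
  · rwa [Finsupp.support_smul_eq hS'.ne']
  · rw [Finsupp.sum_smul_index fun _ => rfl, ← Finsupp.mul_sum, ← hS, inv_mul_cancel₀ hpos.ne']
  · rw [toSpace_smul hS']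
    rcases h3 with h | h
    · exact ⟨S⁻¹, by rw [h]⟩
    · exact ⟨-S⁻¹, by rw [h]; simp⟩

/-! ### The model and the conclusion -/

/-- The model of `P^3` on two cycles of length `n`, two apices and two poles. -/
noncomputable def model (n : ℤ) (hn : 3 ≤ n) : ProjectiveModel Vert 3 where
  g := antipode n
  faces := {σ | IsSimplex n σ}
  nonempty_of_mem _ h := h.nonempty
  mem_of_subset _ h _ hτ hne := h.mono hτ hne
  smul_mem _ := isSimplex_smul_iff
  exists_finite := exists_finite_representatives hn
  rigid _ h _ hx k hk := h.rigid hn hx k hk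
  map := toSpace n
  continuous_map _ e _ := continuous_toSpace e
  map_ne_zero _ ht hσ := toSpace_ne_zero (by omega) ht hσ
  map_odd := toSpace_antipode (by omega)
  map_surjective _ hP := exists_toSpace_eq_smul hn hP
  map_injective _ _ h₁ hσ₁ hs₁ h₂ hσ₂ hs₂ _ h :=
    exists_zpow_of_toSpace_eq_smul (by omega) h₁ hσ₁ hs₁ h₂ hσ₂ hs₂ h

theorem embedsAsQuadrangulation_top (m : ℕ) (hm : 3 ≤ m) {W : Type*} (e : W ≃ Fin m ⊕ Bool) :
    EmbedsAsQuadrangulation (⊤ : SimpleGraph W) (RealProjectiveSpace 3) := by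
  have hm' : (3 : ℤ) ≤ m := by exact_mod_cast hm
  refine (model m hm').embedsAsQuadrangulation_top Prod.fst (antipode_fst _)
    (fun σ h hσ => h.exists_insert hm' hσ)
    (fun x y x' y' h h' => exists_zpow_of_edges hm' h h')
    (exists_edge_of_not_sameCycle hm') (representative m ∘ e) isSimplex_singleton fun v => ?_
  obtain ⟨w, hw, huniq⟩ := existsUnique_representative m (by omega) v
  refine ⟨e.symm w, ?_, fun w' h => ?_⟩
  · change (antipode m).SameCycle _ _
    rwa [Function.comp_apply, Equiv.apply_symm_apply]
  · rw [Equiv.eq_symm_apply]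
    exact huniq _ h

end DoubleCycle

theorem mainTheorem4 (r : ℕ) (hr : 3 ≤ r) :
    EmbedsAsQuadrangulation (⊤ : SimpleGraph (Fin (2 * r + 3))) (RealProjectiveSpace 3) :=
  -- The quotient has `2r + 1` cycle vertices, one apex and one pole.
  DoubleCycle.embedsAsQuadrangulation_top (2 * r + 1) (by omega)
    (Fintype.equivOfCardEq (by simp))
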